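/- Let $\mathbf r=\{r_k\}_{k\ge1}$ be a sequence of integers with $0\le r_1\le r_2\le\cdots$. For $r\in\mathbb N_0$ let $$K_{1,r}(x,y)=\int_{[0,1]^r}\min(x,s_1)\min(s_1,s_2)\cdots\min(s_r,y)\,ds_1\cdots ds_r,\qquad x,y\in[0,1],$$ (so $K_{1,0}(x,y)=\min(x,y)$) be the integrated Euler kernel. For $d\ge1$ let $H_d$ be the real reproducing kernel Hilbert space on $[0,1]^d$ with kernel $K_d(\mathbf x,\mathbf y)=\prod_{k=1}^d K_{1,r_k}(x_k,y_k)$, and let $\mathrm{APP}_d:H_d\to L_2([0,1]^d)$ be the embedding $\mathrm{APP}_d f=f$. For $n\ge1$ let $e(n,d)$ be the infimum of $\sup_{\|f\|_{H_d}\le1}\|f-A(f)\|_{L_2}$ over all algorithms $A(f)=\varphi(L_1(f),\dots,L_n(f))$ with continuous linear functionals $L_i$ on $H_d$ and measurable $\varphi:\mathbb R^n\to L_2([0,1]^d)$, and let $e(0,d)=\sup_{\|f\|_{H_d}\le1}\|f\|_{L_2}$. For $\varepsilon\in(0,1)$ let $n(\varepsilon,d)=\min\{n\ge0: e(n,d)\le\varepsilon\,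 e(0,d)\}$ be the information complexity for the normalized error criterion. The problem $\mathrm{APP}=\{\mathrm{APP}_d\}_{d\ge1}$ is called * strongly polynomially tractable (SPT) if there are $C,p\ge0$ with $n(\varepsilon,d)\le C\varepsilon^{-p}$ for all $d\ge1$, $\varepsilon\in(0,1)$; the infimum $p^*$ of such $p$ is the exponent of SPT; * polynomially tractable (PT) if there are $C,p,q\ge0$ with $n(\varepsilon,d)\le Cd^q\varepsilon^{-p}$ for all $d\ge1$, $\varepsilon\in(0,1)$; * quasi-polynomially tractable (QPT) if there are $C,t>0$ with $n(\varepsilon,d)\le C\exp(t(1+\ln d)(1+\ln\varepsilon^{-1}))$ for all $d\ge1$, $\varepsilon\in(0,1)$; the infimum $t^*$ of such $t$ is the exponent of QPT; * $(s,t)$-weakly tractable ($s,t>0$) if $\ln n(\varepsilon,d)/(\varepsilon^{-s}+d^t)\to0$ as $\varepsilon^{-1}+d\to\infty$; weakly tractable (WT) if this holds for $s=t=1$; uniformly weakly tractable (UWT) if it holds for all $s,t>0$. Then the following hold, with values in $[0,\infty]$ and $2/\infty=0$. 1. $\mathrm{APP}$ is SPT if and only if $$A_*:=\liminf_{k\to\infty}\frac{(2r_k+2)\ln3}{\ln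 k}=2\ln3\,\liminf_{k\to\infty}\frac{r_k}{\ln k}>0,$$ and in that case $p^*=\max\{2/A_*,\,1/(r_1+1)\}$. (The equality of the two expressions for $A_*$ holds for every such $\mathbf r$.) 2. $\mathrm{APP}$ is SPT if and only if it is PT. 3. $\mathrm{APP}$ is QPT for every such $\mathbf r$, and $$t^*=\max\Big\{\frac{2}{\lim_{k\to\infty}(2r_k+2)\ln3},\,\frac1{r_1+1}\Big\}=\frac1{r_1+1}.$$ 4. For every such $\mathbf r$, $\mathrm{APP}$ is UWT, WT, and $(s,t)$-weakly tractable for all $s,t>0$. -/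

import Mathlib

open MeasureTheory unitInterval
open scoped ENNReal

noncomputable section
namespace EulerTractability

/-- The sequence `x, s₁, …, s_r, y` of points of `[0,1]`. -/
def eulerPath {r : ℕ} (x : I) (s : Fin r → I) (y : I) : Fin (r + 2) → I :=
  Fin.snoc (α := fun _ => I) (Fin.cons x s : Fin (r + 1) → I) y

/-- The integrand `min(x, s₁) min(s₁, s₂) ⋯ min(s_r, y)` of the Euler kernel. -/
def eulerChain {r : ℕ} (x : I) (s : Fin r → I) (y : I) : ℝ :=
  ∏ i : Fin (r + 1), ((min (eulerPath x s y i.castSucc) (eulerPath x s y i.succ) : I) : ℝ)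

/-- The univariate integrated Euler kernel
`K_r(x, y) = ∫_{[0,1]^r} min(x, s₁) min(s₁, s₂) ⋯ min(s_r, y) ds`; for `r = 0` it is `min(x, y)`. -/
def eulerKernel (r : ℕ) (x y : I) : ℝ :=
  ∫ s : Fin r → I, eulerChain x s y

theorem eulerKernel_zero (x y : I) : eulerKernel 0 x y = ((min x y : I) : ℝ) := by
  simp [eulerKernel, eulerChain, eulerPath, Fin.snoc, integral_unique]

theorem continuous_eulerPath (r : ℕ) (i : Fin (r + 2)) :
    Continuous fun p : (I × I) × (Fin r → I) => eulerPath p.1.1 p.2 p.1.2 i := by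
  have h : ∀ j, Continuous fun p : (I × I) × (Fin r → I) =>
      (Fin.cons p.1.1 p.2 : Fin (r + 1) → I) j := by
    intro j
    refine Fin.cases ?_ (fun j => ?_) j
    · simpa using (by fun_prop : Continuous fun p : (I × I) × (Fin r → I) => p.1.1)
    · simpa using (by fun_prop : Continuous fun p : (I × I) × (Fin r → I) => p.2 j)
  unfold eulerPath
  refine Fin.lastCases ?_ (fun j => ?_) i
  · simpa using (by fun_prop : Continuous fun p : (I × I) × (Fin r → I) => p.1.2)
  · simpa using h j

theorem continuous_eulerChain (r : ℕ) :
    Continuous fun p : (I × I) × (Fin r → I) => eulerChain p.1.1 p.2 p.1.2 :=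
  continuous_finsetProd _ fun _ _ =>
    continuous_subtype_val.comp ((continuous_eulerPath r _).min (continuous_eulerPath r _))

theorem continuous_eulerKernel (r : ℕ) : Continuous fun p : I × I => eulerKernel r p.1 p.2 := by
  have h := continuous_parametric_integral_of_continuous
    (μ := (volume : Measure (Fin r → I))) (X := I × I)
    (f := fun p s => eulerChain p.1 s p.2)
    (continuous_eulerChain r) (s := Set.univ) isCompact_univ
  simp only [setIntegral_univ] at h
  exact h

theorem eulerChain_cons {r : ℕ} (x y t : I) (s : Fin r → I) :
    eulerChain x (Fin.cons t s : Fin (r + 1) → I) y = ((min x t : I) : ℝ) * eulerChain t s y := by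
  unfold eulerChain eulerPath
  rw [Fin.prod_univ_succ, ← Fin.cons_snoc_eq_snoc_cons]
  simp only [Fin.castSucc_zero, Fin.cons_zero, Fin.cons_succ, ← Fin.succ_castSucc]
  congr 3

theorem integrable_of_continuous {α : Type*} [MeasurableSpace α] [TopologicalSpace α]
    [OpensMeasurableSpace α] [CompactSpace α] {μ : Measure α} [IsFiniteMeasure μ] {f : α → ℝ}
    (hf : Continuous f) : Integrable f μ := by
  obtain ⟨C, hC⟩ := (isCompact_univ.image hf).isBounded.exists_norm_le
  exact Integrable.of_bound hf.measurable.aestronglyMeasurable C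
    (Filter.Eventually.of_forall fun a => hC _ ⟨a, Set.mem_univ a, rfl⟩)

theorem integrable_of_bdd {α : Type*} [MeasurableSpace α] {μ : Measure α} [IsFiniteMeasure μ]
    {f : α → ℝ} (hf : Measurable f) (hb : ∀ a, |f a| ≤ 1) : Integrable f μ :=
  Integrable.of_bound hf.aestronglyMeasurable 1 (Filter.Eventually.of_forall hb)

theorem eulerKernel_succ (r : ℕ) (x y : I) :
    eulerKernel (r + 1) x y = ∫ s : I, ((min x s : I) : ℝ) * eulerKernel r s y := by
  have hint : Integrable (fun p : I × (Fin r → I) =>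
      ((min x p.1 : I) : ℝ) * eulerChain p.1 p.2 y)
      ((volume : Measure I).prod (volume : Measure (Fin r → I))) := by
    have hc : Continuous fun p : I × (Fin r → I) => ((p.1, y), p.2) := by fun_prop
    have hc2 : Continuous fun p : I × (Fin r → I) => ((min x p.1 : I) : ℝ) := by fun_prop
    exact integrable_of_continuous (hc2.mul ((continuous_eulerChain r).comp hc))
  have e := ((volume_preserving_piFinSuccAbove (fun _ : Fin (r + 1) => I) 0).symm).integral_comp'
    (g := fun s : Fin (r + 1) → I => eulerChain x s y)
  have e2 : ∀ p : I × (Fin r → I),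
      eulerChain x ((MeasurableEquiv.piFinSuccAbove (fun _ : Fin (r + 1) => I) 0).symm p) y =
        ((min x p.1 : I) : ℝ) * eulerChain p.1 p.2 y := by
    intro p
    rw [← eulerChain_cons]
    simp [MeasurableEquiv.piFinSuccAbove_symm_apply, Fin.insertNthEquiv]
  simp_rw [e2] at e
  unfold eulerKernel
  rw [← e, Measure.volume_eq_prod, integral_prod _ hint]
  simp only [integral_const_mul]

theorem eulerKernel_succ' (r : ℕ) (x y : I) :
    eulerKernel (r + 1) x y = ∫ s : I, eulerKernel r x s * ((min s y : I) : ℝ) := by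
  induction r generalizing x y with
  | zero => simp only [eulerKernel_succ, eulerKernel_zero]
  | succ r ih =>
    rw [eulerKernel_succ]
    simp_rw [ih, ← integral_const_mul]
    rw [integral_integral_swap]
    · simp_rw [← mul_assoc, integral_mul_const, ← eulerKernel_succ, ih]
    · have h1 : Continuous fun p : I × I => ((min x p.1 : I) : ℝ) := by fun_prop
      have h2 : Continuous fun p : I × I => ((min p.2 y : I) : ℝ) := by fun_prop
      have := h1.mul ((continuous_eulerKernel r).mul h2)
      exact integrable_of_continuous this

theorem exists_feature (r : ℕ) : ∃ φ : I → I → ℝ, Measurable (Function.uncurry φ) ∧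
    (∀ x u, |φ x u| ≤ 1) ∧ ∀ x y, eulerKernel r x y = ∫ u : I, φ x u * φ y u := by
  have hmin : ∀ x s : I, |((min x s : I) : ℝ)| ≤ 1 := fun x s => by
    rw [abs_of_nonneg (min x s).2.1]; exact (min x s).2.2
  have hmul : ∀ {a b : ℝ}, |a| ≤ 1 → |b| ≤ 1 → |a * b| ≤ 1 := fun ha hb => by
    rw [abs_mul]; exact mul_le_one₀ ha (abs_nonneg _) hb
  induction r using Nat.twoStepInduction with
  | zero =>
    refine ⟨fun x u => if u ≤ x then 1 else 0, ?_, ?_, ?_⟩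
    · refine Measurable.ite (measurableSet_le measurable_snd measurable_fst) ?_ ?_ <;> fun_prop
    · intro x u; dsimp only; split_ifs <;> simp
    · intro x y
      have : ∀ u : I, ((if u ≤ x then (1 : ℝ) else 0) * if u ≤ y then 1 else 0) =
          (Set.Iic (min x y)).indicator 1 u := by
        intro u
        by_cases h1 : u ≤ x <;> by_cases h2 : u ≤ y <;> simp [Set.indicator, h1, h2]
      simp_rw [this, eulerKernel_zero]
      rw [integral_indicator_one measurableSet_Iic, Measure.real, unitInterval.volume_Iic,
        ENNReal.toReal_ofReal (min x y).2.1]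
  | one =>
    refine ⟨fun x u => ((min x u : I) : ℝ), ?_, hmin, ?_⟩
    · exact Continuous.measurable (by simp only [Function.uncurry_def]; fun_prop)
    · intro x y
      simp_rw [eulerKernel_succ, eulerKernel_zero, min_comm y]
  | more r ih _ =>
    obtain ⟨φ, hm, hb, hφ⟩ := ih
    have hmm : Measurable fun p : (I × I) × I => ((min p.1.1 p.2 : I) : ℝ) * φ p.2 p.1.2 := by
      refine Measurable.mul (Continuous.measurable (by fun_prop)) ?_
      exact hm.comp (measurable_snd.prodMk (measurable_snd.comp measurable_fst))
    set ψ : I → I → ℝ := fun x u => ∫ s : I, ((min x s : I) : ℝ) * φ s u with hψ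
    have hψm : Measurable (Function.uncurry ψ) :=
      (hmm.stronglyMeasurable.integral_prod_right (ν := (volume : Measure I))).measurable
    have hψb : ∀ x u, |ψ x u| ≤ 1 := by
      intro x u
      have := norm_integral_le_of_norm_le_const (μ := (volume : Measure I))
        (f := fun s => ((min x s : I) : ℝ) * φ s u) (C := 1)
        (Filter.Eventually.of_forall fun s => hmul (hmin x s) (hb s u))
      simpa [hψ] using this
    refine ⟨ψ, hψm, hψb, fun x y => ?_⟩
    have h1 : ∀ s, eulerKernel (r + 1) s y = ∫ u, φ s u * ψ y u := by
      intro s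
      rw [eulerKernel_succ']
      simp_rw [hφ, ← integral_mul_const]
      rw [integral_integral_swap]
      · refine integral_congr_ae (Filter.Eventually.of_forall fun u => ?_)
        simp only [hψ, mul_assoc, integral_const_mul]
        congr 2
        ext t
        rw [min_comm, mul_comm]
      · refine integrable_of_bdd ?_ fun p => hmul (hmul (hb _ _) (hb _ _)) (hmin _ _)
        refine Measurable.mul (Measurable.mul ?_ ?_) (Continuous.measurable (by fun_prop))
        · exact hm.comp (measurable_const.prodMk measurable_snd)
        · exact hm
    rw [eulerKernel_succ]
    simp_rw [h1, ← integral_const_mul]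
    rw [integral_integral_swap]
    · simp_rw [← mul_assoc, integral_mul_const, hψ]
    · refine integrable_of_bdd ?_ fun p => hmul (hmin _ _) (hmul (hb _ _) (hψb _ _))
      refine Measurable.mul (Continuous.measurable (by fun_prop)) (Measurable.mul hm ?_)
      exact hψm.comp (measurable_const.prodMk measurable_snd)

/-- The product kernel `K_{d,r}(x, y) = ∏_{k=1}^d K_{r_k}(x_k, y_k)` on `[0,1]^d`. Smoothness
parameters are numbered from `1`, so the coordinate `k : Fin d` carries the parameter `r (k + 1)`. -/
def tensorEulerKernel (r : ℕ → ℕ) (d : ℕ) (x y : Fin d → I) : ℝ :=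
  ∏ k : Fin d, eulerKernel (r (k + 1)) (x k) (y k)

theorem exists_tensor_feature (r : ℕ → ℕ) (d : ℕ) :
    ∃ Φ : (Fin d → I) → (Fin d → I) → ℝ, (∀ x, Measurable (Φ x)) ∧ (∀ x u, |Φ x u| ≤ 1) ∧
      ∀ x y, tensorEulerKernel r d x y = ∫ u, Φ x u * Φ y u := by
  choose φ hm hb hφ using exists_feature
  refine ⟨fun x u => ∏ k : Fin d, φ (r (k + 1)) (x k) (u k), fun x => ?_, fun x u => ?_,
    fun x y => ?_⟩
  · refine Finset.measurable_fun_prod _ fun k _ => ?_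
    exact (hm (r (k + 1))).comp (measurable_const.prodMk (measurable_pi_apply k))
  · rw [Finset.abs_prod]
    exact Finset.prod_le_one (fun _ _ => abs_nonneg _) fun _ _ => hb _ _ _
  · simp_rw [tensorEulerKernel, ← Finset.prod_mul_distrib, hφ]
    rw [← integral_fintype_prod_volume_eq_prod
      (fun (k : Fin d) (u : I) => φ (r (k + 1)) (x k) u * φ (r (k + 1)) (y k) u)]

/-- The kernel `K_{d,r}` as an operator-valued matrix, the format used by `RKHS.OfKernel`. -/
def eulerMatrix (r : ℕ → ℕ) (d : ℕ) : Matrix (Fin d → I) (Fin d → I) (ℝ →L[ℝ] ℝ) :=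
  Matrix.of fun x y => tensorEulerKernel r d x y • ContinuousLinearMap.id ℝ ℝ

theorem eulerMatrix_posSemidef (r : ℕ → ℕ) (d : ℕ) : (eulerMatrix r d).PosSemidef := by
  obtain ⟨Φ, hm, hb, hΦ⟩ := exists_tensor_feature r d
  have hi : ∀ x y, Integrable fun u => Φ x u * Φ y u := fun x y =>
    integrable_of_bdd ((hm x).mul (hm y)) fun u => by
      rw [abs_mul]; exact mul_le_one₀ (hb _ _) (abs_nonneg _) (hb _ _)
  have tfae := (RKHS.posSemidef_tfae (𝕜 := ℝ) (K := eulerMatrix r d)).out 0 2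
  refine tfae.mpr ⟨?_, fun v => ?_⟩
  · refine Matrix.IsHermitian.ext fun x y => ?_
    simp only [eulerMatrix, Matrix.of_apply, star_smul, star_trivial, hΦ]
    congr 1
    · simp_rw [mul_comm]
    · exact star_one (ℝ →L[ℝ] ℝ)
  · have : (v.sum fun x w => v.sum fun x' w' => inner ℝ (eulerMatrix r d x' x w) w') =
        ∫ u, (v.sum fun x w => w * Φ x u) ^ 2 := by
      simp only [Finsupp.sum, eulerMatrix, Matrix.of_apply]
      simp_rw [sq, Finset.sum_mul_sum]
      rw [integral_finsetSum]
      · refine Finset.sum_congr rfl fun x _ => ?_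
        rw [integral_finsetSum]
        · refine Finset.sum_congr rfl fun y _ => ?_
          simp only [smul_apply, ContinuousLinearMap.id_apply, hΦ]
          simp only [smul_eq_mul, RCLike.inner_apply, conj_trivial, ← integral_mul_const,
            ← integral_const_mul]
          congr 1; ext u; ring
        · intro y _
          have := (hi x y).const_mul (v x * v y)
          refine this.congr (Filter.Eventually.of_forall fun u => ?_)
          simp only; ring
      · intro x _
        refine integrable_finsetSum _ fun y _ => ?_
        have := (hi x y).const_mul (v x * v y)
        refine this.congr (Filter.Eventually.of_forall fun u => ?_)
        simp only; ring
    rw [this]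
    exact integral_nonneg fun u => sq_nonneg _

instance (r : ℕ → ℕ) (d : ℕ) : Fact (eulerMatrix r d).PosSemidef := ⟨eulerMatrix_posSemidef r d⟩

/-- The reproducing kernel Hilbert space `H(K_{d,r})` of the kernel `K_{d,r}`. -/
abbrev EulerSpace (r : ℕ → ℕ) (d : ℕ) : Type := RKHS.OfKernel (eulerMatrix r d)

theorem continuous_tensorEulerKernel (r : ℕ → ℕ) (d : ℕ) :
    Continuous fun p : (Fin d → I) × (Fin d → I) => tensorEulerKernel r d p.1 p.2 :=
  continuous_finsetProd _ fun k _ => (continuous_eulerKernel (r (k + 1))).comp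
    (f := fun p : (Fin d → I) × (Fin d → I) => (p.1 k, p.2 k)) (by fun_prop)

theorem continuous_coe (r : ℕ → ℕ) (d : ℕ) (f : EulerSpace r d) : Continuous fun x => f x := by
  have hk : ∀ x y : Fin d → I,
      inner ℝ (RKHS.kerFun (EulerSpace r d) x 1) (RKHS.kerFun (EulerSpace r d) y 1) =
        tensorEulerKernel r d x y := by
    intro x y
    rw [RKHS.kerFun_inner, RKHS.kerFun_apply, RKHS.OfKernel.kernel_ofKernel]
    simp [eulerMatrix]
  have hd : ∀ x y : Fin d → I,
      ‖RKHS.kerFun (EulerSpace r d) x 1 - RKHS.kerFun (EulerSpace r d) y 1‖ ^ 2 =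
        tensorEulerKernel r d x x - 2 * tensorEulerKernel r d x y + tensorEulerKernel r d y y := by
    intro x y
    rw [norm_sub_sq_real, ← real_inner_self_eq_norm_sq, ← real_inner_self_eq_norm_sq, hk, hk, hk]
  have hc : Continuous fun x => RKHS.kerFun (EulerSpace r d) x 1 := by
    rw [continuous_iff_continuousAt]
    intro y
    rw [ContinuousAt, tendsto_iff_norm_sub_tendsto_zero]
    have h2 : Continuous fun x : Fin d → I => 
        √(tensorEulerKernel r d x x - 2 * tensorEulerKernel r d x y + tensorEulerKernel r d y y) := by
      have a := (continuous_tensorEulerKernel r d).comp (continuous_id.prodMk continuous_id)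
      have b := (continuous_tensorEulerKernel r d).comp
        (continuous_id.prodMk (continuous_const (y := y)))
      exact ((a.sub (b.const_mul 2)).add continuous_const).sqrt
    have h3 := h2.tendsto y
    have e : ∀ x, ‖RKHS.kerFun (EulerSpace r d) x 1 - RKHS.kerFun (EulerSpace r d) y 1‖ = 
       √(tensorEulerKernel r d x x - 2 * tensorEulerKernel r d x y + tensorEulerKernel r d y y) := by
      intro x
      rw [← hd, Real.sqrt_sq (norm_nonneg _)]
    simp_rw [← e] at h3
    simpa using h3
  have : (fun x => f x) = fun x => inner ℝ (RKHS.kerFun (EulerSpace r d) x 1) f := by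
    ext x
    rw [RKHS.kerFun_inner]; simp
  rw [this]
  exact hc.inner continuous_const

theorem tensorEulerKernel_self_le (r : ℕ → ℕ) (d : ℕ) (x : Fin d → I) :
    |tensorEulerKernel r d x x| ≤ 1 := by
  obtain ⟨Φ, hm, hb, hΦ⟩ := exists_tensor_feature r d
  rw [hΦ]
  have := norm_integral_le_of_norm_le_const (μ := (volume : Measure (Fin d → I)))
    (f := fun u => Φ x u * Φ x u) (C := 1) (Filter.Eventually.of_forall fun u => by
      rw [Real.norm_eq_abs, abs_mul]; exact mul_le_one₀ (hb _ _) (abs_nonneg _) (hb _ _))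
  simpa using this

/-- Elements of `H(K_{d,r})` as continuous functions on `[0,1]^d`. -/
def toContinuousMap (r : ℕ → ℕ) (d : ℕ) : EulerSpace r d →L[ℝ] C(Fin d → I, ℝ) :=
  LinearMap.mkContinuous
    { toFun := fun f => ⟨fun x => f x, continuous_coe r d f⟩
      map_add' := fun f g => by ext x; simp
      map_smul' := fun c f => by ext x; simp }
    1 fun f => by
      refine (ContinuousMap.norm_le _ (by positivity)).mpr fun x => ?_
      refine (RKHS.norm_apply_le f x).trans ?_
      rw [RKHS.OfKernel.kernel_ofKernel, one_mul]
      refine mul_le_of_le_one_right (norm_nonneg _) (Real.sqrt_le_one.mpr ?_)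
      simpa [eulerMatrix, norm_smul] using tensorEulerKernel_self_le r d x

/-- The embedding `APP_d : H(K_{d,r}) → L₂([0,1]^d)`, `APP_d f = f`. -/
def APP (r : ℕ → ℕ) (d : ℕ) :
    EulerSpace r d →L[ℝ] Lp ℝ 2 (volume : Measure (Fin d → I)) :=
  (ContinuousMap.toLp 2 volume ℝ).comp (toContinuousMap r d)

theorem coeFn_APP (r : ℕ → ℕ) (d : ℕ) (f : EulerSpace r d) :
    APP r d f =ᵐ[volume] fun x => f x :=
  ContinuousMap.coeFn_toLp (E := ℝ) volume (toContinuousMap r d f)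

section WorstCase

variable {H G : Type*} [NormedAddCommGroup H] [InnerProductSpace ℝ H]
  [NormedAddCommGroup G] [InnerProductSpace ℝ G]

/-- Algorithms `A f = φ (L₁ f, …, L_n f)` with continuous linear functionals `L_i` and an
arbitrary (Borel) measurable map `φ : ℝ^n → G`. -/
def IsAlgorithm (n : ℕ) (A : H → G) : Prop :=
  ∃ (L : Fin n → H →L[ℝ] ℝ) (φ : (Fin n → ℝ) → G),
    @Measurable _ _ _ (borel G) φ ∧ ∀ f, A f = φ fun i => L i f

/-- The worst case error `sup_{‖f‖ ≤ 1} ‖S f - A f‖`, possibly infinite. -/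
def worstCaseError (S : H →L[ℝ] G) (A : H → G) : ℝ≥0∞ :=
  ⨆ (f : H) (_ : ‖f‖ ≤ 1), ‖S f - A f‖ₑ

/-- The `n`-th minimal worst case error `e(n, S)`; for `n = 0` only the zero algorithm is used,
so that `e(0, S)` is the initial error `‖S‖`. -/
def minimalError (S : H →L[ℝ] G) (n : ℕ) : ℝ≥0∞ :=
  if n = 0 then worstCaseError S 0
  else ⨅ (A : H → G) (_ : IsAlgorithm n A), worstCaseError S A

/-- The information complexity `min {n : e(n, S) ≤ ε e(0, S)}` for the normalized error
criterion (`⊤` if there is no such `n`). -/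
def complexityNOR (S : H →L[ℝ] G) (ε : ℝ) : ℕ∞ :=
  ⨅ (n : ℕ) (_ : minimalError S n ≤ ENNReal.ofReal ε * minimalError S 0), (n : ℕ∞)

end WorstCase

/-! Tractability notions for an information complexity `N ε d`, `ε ∈ (0,1)`, `d = 1, 2, …`. -/

/-- `N ε d ≤ C ε^{-p}` for all `d` and `ε`, for some `C ≥ 0`. -/
def SPTBound (N : ℝ → ℕ → ℕ∞) (p : ℝ) : Prop :=
  ∃ C : ℝ, 0 ≤ C ∧ ∀ d : ℕ, 1 ≤ d → ∀ ε : ℝ, 0 < ε → ε < 1 →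
    (N ε d : ℝ≥0∞) ≤ ENNReal.ofReal (C * ε⁻¹ ^ p)

/-- Strong polynomial tractability. -/
def SPT (N : ℝ → ℕ → ℕ∞) : Prop := ∃ p : ℝ, 0 ≤ p ∧ SPTBound N p

/-- The exponent of strong polynomial tractability, as an infimum of extended reals. -/
def exponentSPT (N : ℝ → ℕ → ℕ∞) : EReal :=
  sInf {q : EReal | ∃ p : ℝ, 0 ≤ p ∧ SPTBound N p ∧ q = (p : EReal)}

/-- Polynomial tractability. -/
def PT (N : ℝ → ℕ → ℕ∞) : Prop :=
  ∃ C p q : ℝ, 0 ≤ C ∧ 0 ≤ p ∧ 0 ≤ q ∧ ∀ d : ℕ, 1 ≤ d → ∀ ε : ℝ, 0 < ε → ε < 1 →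
    (N ε d : ℝ≥0∞) ≤ ENNReal.ofReal (C * (d : ℝ) ^ q * ε⁻¹ ^ p)

/-- `N ε d ≤ C exp(t (1 + ln d) (1 + ln ε^{-1}))` for all `d` and `ε`, for some `C > 0`. -/
def QPTBound (N : ℝ → ℕ → ℕ∞) (t : ℝ) : Prop :=
  ∃ C : ℝ, 0 < C ∧ ∀ d : ℕ, 1 ≤ d → ∀ ε : ℝ, 0 < ε → ε < 1 →
    (N ε d : ℝ≥0∞) ≤
      ENNReal.ofReal (C * Real.exp (t * (1 + Real.log d) * (1 + Real.log ε⁻¹)))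

/-- Quasi-polynomial tractability. -/
def QPT (N : ℝ → ℕ → ℕ∞) : Prop := ∃ t : ℝ, 0 < t ∧ QPTBound N t

/-- The exponent of quasi-polynomial tractability, as an infimum of extended reals. -/
def exponentQPT (N : ℝ → ℕ → ℕ∞) : EReal :=
  sInf {q : EReal | ∃ t : ℝ, 0 < t ∧ QPTBound N t ∧ q = (t : EReal)}

/-- The limit process `ε^{-1} + d → ∞` over pairs `(ε, d)` with `ε ∈ (0,1)` and `d ≥ 1`. -/
def tractabilityFilter : Filter (ℝ × ℕ) :=
  Filter.comap (fun x : ℝ × ℕ => x.1⁻¹ + (x.2 : ℝ)) Filter.atTop ⊓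
    Filter.principal {x | 0 < x.1 ∧ x.1 < 1 ∧ 1 ≤ x.2}

/-- `(s, t)`-weak tractability: `ln N(ε, d) / (ε^{-s} + d^t) → 0` as `ε^{-1} + d → ∞`. -/
def STWeaklyTractable (N : ℝ → ℕ → ℕ∞) (s t : ℝ) : Prop :=
  Filter.Tendsto
    (fun x : ℝ × ℕ => ENNReal.log (N x.1 x.2 : ℝ≥0∞) /
      ((x.1⁻¹ ^ s + (x.2 : ℝ) ^ t : ℝ) : EReal))
    tractabilityFilter (nhds 0)

/-- Uniform weak tractability. -/
def UWT (N : ℝ → ℕ → ℕ∞) : Prop :=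
  ∀ α β : ℝ, 0 < α → 0 < β → STWeaklyTractable N α β

/-- Weak tractability. -/
def WT (N : ℝ → ℕ → ℕ∞) : Prop :=
  Filter.Tendsto
    (fun x : ℝ × ℕ => ENNReal.log (N x.1 x.2 : ℝ≥0∞) / ((x.1⁻¹ + (x.2 : ℝ) : ℝ) : EReal))
    tractabilityFilter (nhds 0)

/-- The information complexity of the problem `APP = {APP_d}` for the normalized error
criterion. -/
def eulerComplexity (r : ℕ → ℕ) (ε : ℝ) (d : ℕ) : ℕ∞ := complexityNOR (APP r d) ε

/-- `A_* = liminf_{k → ∞} (2 r_k + 2) ln 3 / ln k`, an element of `[0, ∞]`. -/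
def eulerAStar (r : ℕ → ℕ) : EReal :=
  Filter.liminf
    (fun k : ℕ => (((2 * (r k : ℝ) + 2) * Real.log 3 / Real.log (k : ℝ) : ℝ) : EReal))
    Filter.atTop

end EulerTractability

end

open MeasureTheory unitInterval
open scoped ENNReal

noncomputable section
namespace EulerTractability

/-! ### Information complexity from singular values. -/

section SingularValues

variable {H G ι : Type*} [NormedAddCommGroup H] [InnerProductSpace ℝ H]
  [NormedAddCommGroup G] [InnerProductSpace ℝ G]

/-! The integral operator with kernel `min` has eigenfunctions `√2 sin((j + 1/2)πx)`, with
eigenvalues `(2/((2j+1)π))²`. Integrated Euler kernels are iterates of `min`, so they keep the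
eigenfunctions and raise the eigenvalues to the power `r + 1`; tensor products multiply them. This
gives a singular system of `APP` with singular values `c / ∏ (2 m_k + 1)^(r_k + 1)`. The normalized
criterion cancels `c`, and the complexity is exactly the number of `m` with `∏ (2 m_k + 1)^(r_k + 1)
< 1/ε` (`eulerComplexity_eq_encard`). Everything else is about this count.

Upper bounds come from Rankin's trick (`exists_ncard_oddIndices_le`): with `X = 1/ε`, the count is
at most `X^p exp(C ∑ 3^(-p(r_k+1)))` once `p(r_1+1)` exceeds 1 by a fixed margin. If also `2/p <
A_*`, the sum is bounded in `d`, which gives SPT. Letting `p = t(1 + ln d)` bounds the sum by 1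
whatever the growth of `r`, which gives QPT, and QPT already implies all the weak notions.

Lower bounds use two families of indices. In dimension one the count grows like `X^(1/(r_1+1))`,
forcing both exponents to be at least `1/(r_1+1)`. The 0/1 indices with `l` ones give `d.choose l`
solutions at `X` just above `3^(l(r_d+1))`, which bounds `A_*` from below
(`le_eulerAStar_of_forall_le`): `l = 1` gives the sharp SPT exponent, and `l > q` shows that PT
already forces `A_* > 0`. -/

theorem norm_sq_sum_smul {v : ι → G} (hv : Orthonormal ℝ v) (a : ι → ℝ) (s : Finset ι) :
    ‖∑ i ∈ s, a i • v i‖ ^ 2 = ∑ i ∈ s, a i ^ 2 := by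
  rw [← real_inner_self_eq_norm_sq, hv.inner_sum]
  simp [sq]

/-- Coefficientwise comparison followed by Bessel's inequality for `f`. Two vectors are allowed so
that the same estimate bounds the norm of `S` (`g = f`) and the error of a spectral truncation (`g`
the tail of `f`). -/
theorem norm_apply_le_of_coeff_le {S : H →L[ℝ] G} (e : HilbertBasis ι ℝ H) {τ : ι → ℝ}
    {v : ι → G} (hv : Orthonormal ℝ v) (hS : ∀ i, S (e i) = τ i • v i) {c : ℝ} (hc : 0 ≤ c)
    {f g : H} (h : ∀ i, |inner ℝ (e i) g * τ i| ≤ c * |inner ℝ (e i) f|) :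
    ‖S g‖ ≤ c * ‖f‖ := by
  have h1 : HasSum (fun i => (inner ℝ (e i) g * τ i) • v i) (S g) := by
    have := (e.hasSum_repr g).mapL S
    simpa [e.repr_apply_apply, hS, smul_smul] using this
  refine le_of_tendsto h1.norm (Filter.Eventually.of_forall fun s => ?_)
  refine abs_le_of_sq_le_sq' ?_ (by positivity) |>.2
  rw [norm_sq_sum_smul hv, mul_pow]
  calc ∑ i ∈ s, (inner ℝ (e i) g * τ i) ^ 2 ≤ ∑ i ∈ s, c ^ 2 * ‖inner ℝ (e i) f‖ ^ 2 := by
        refine Finset.sum_le_sum fun i _ => ?_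
        rw [← mul_pow, ← sq_abs]
        exact pow_le_pow_left₀ (abs_nonneg _) (h i) 2
    _ ≤ c ^ 2 * ‖f‖ ^ 2 := by
        rw [← Finset.mul_sum]
        exact mul_le_mul_of_nonneg_left (e.orthonormal.sum_inner_products_le f) (sq_nonneg c)

theorem worstCaseError_le {S : H →L[ℝ] G} {A : H → G} {c : ℝ} (hc : 0 ≤ c)
    (h : ∀ f, ‖S f - A f‖ ≤ c * ‖f‖) : worstCaseError S A ≤ ENNReal.ofReal c := by
  refine iSup₂_le fun f hf => ?_
  rw [← ofReal_norm]
  exact ENNReal.ofReal_le_ofReal ((h f).trans (mul_le_of_le_one_right hc hf))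

omit [InnerProductSpace ℝ G] in
theorem isAlgorithm_zero : IsAlgorithm 0 (0 : H → G) :=
  ⟨fun _ => 0, fun _ => 0, @measurable_const _ _ (borel G) _ 0, fun _ => rfl⟩

/-- Adversary argument: fewer functionals than basis vectors leave a nonzero `E a` in the span on
which all of them vanish. After normalization, `f` and `-f` yield the same output of `A`, while `S
f` and `-S f` are at distance at least `2c`, so one of the two errors is at least `c`. Nonlinear `φ`
brings no gain. -/
theorem le_worstCaseError {S : H →L[ℝ] G} {e : ι → H} (he : Orthonormal ℝ e) {τ : ι → ℝ}
    {v : ι → G} (hv : Orthonormal ℝ v) (hS : ∀ i, S (e i) = τ i • v i) {c : ℝ} (hc : 0 ≤ c)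
    {s : Finset ι} (hs : ∀ i ∈ s, c ≤ τ i) {n : ℕ} (hn : n < s.card) {A : H → G}
    (hA : IsAlgorithm n A) : ENNReal.ofReal c ≤ worstCaseError S A := by
  obtain ⟨L, φ, -, hA⟩ := hA
  let E : (s → ℝ) →ₗ[ℝ] H := Fintype.linearCombination ℝ (fun i : s => e i)
  let T : (s → ℝ) →ₗ[ℝ] (Fin n → ℝ) := LinearMap.pi fun j => (L j).toLinearMap ∘ₗ E
  have hker : LinearMap.ker T ≠ ⊥ := LinearMap.ker_ne_bot_of_finrank_lt (by simpa using hn)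
  obtain ⟨a, ha, ha0⟩ := (Submodule.ne_bot_iff _).mp hker
  have hes : Orthonormal ℝ fun i : s => e i := he.comp _ Subtype.val_injective
  have hvs : Orthonormal ℝ fun i : s => v i := hv.comp _ Subtype.val_injective
  have hE : ‖E a‖ ^ 2 = ∑ i, a i ^ 2 := by
    simp only [E, Fintype.linearCombination_apply]
    exact norm_sq_sum_smul hes a _
  have hSE : ‖S (E a)‖ ^ 2 = ∑ i, (a i * τ i) ^ 2 := by
    simp only [E, Fintype.linearCombination_apply, map_sum, map_smul, hS, smul_smul]
    exact norm_sq_sum_smul hvs (fun i => a i * τ i) _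
  have hle : c * ‖E a‖ ≤ ‖S (E a)‖ := by
    refine abs_le_of_sq_le_sq' ?_ (norm_nonneg _) |>.2
    rw [mul_pow, hE, hSE, Finset.mul_sum]
    refine Finset.sum_le_sum fun i _ => ?_
    rw [mul_pow, mul_comm]
    exact mul_le_mul_of_nonneg_left (pow_le_pow_left₀ hc (hs i i.2) 2) (sq_nonneg _)
  have hpos : 0 < ‖E a‖ := by
    refine norm_pos_iff.mpr fun h0 => ha0 ?_
    rw [h0, norm_zero, zero_pow two_ne_zero, eq_comm,
      Finset.sum_eq_zero_iff_of_nonneg fun i _ => sq_nonneg _] at hE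
    ext i
    simpa using hE i (Finset.mem_univ i)
  set f : H := ‖E a‖⁻¹ • E a with hf
  have hf1 : ‖f‖ = 1 := by
    rw [hf, norm_smul, norm_inv, norm_norm, inv_mul_cancel₀ hpos.ne']
  have hSf : c ≤ ‖S f‖ := by
    rw [hf, map_smul, norm_smul, norm_inv, norm_norm, inv_mul_eq_div, le_div_iff₀ hpos]
    exact hle
  have hL : ∀ j, L j f = 0 := fun j => by
    have := congrFun (LinearMap.mem_ker.mp ha) j
    simp only [T, LinearMap.pi_apply, LinearMap.comp_apply, Pi.zero_apply] at this
    rw [hf, map_smul]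
    exact smul_eq_zero_of_right _ this
  have hAneg : A (-f) = A f := by simp [hA, hL]
  have key : c ≤ ‖S f - A f‖ ∨ c ≤ ‖S (-f) - A (-f)‖ := by
    by_contra! hcon
    rw [hAneg, map_neg] at hcon
    have : ‖(S f - A f) - (-S f - A f)‖ ≤ _ := norm_sub_le _ _
    have h2 : (S f - A f) - (-S f - A f) = (2 : ℝ) • S f := by rw [two_smul]; abel
    rw [h2, norm_smul, Real.norm_ofNat] at this
    linarith [hcon.1, hcon.2]
  have hfin : ∀ g : H, ‖g‖ ≤ 1 → c ≤ ‖S g - A g‖ → ENNReal.ofReal c ≤ worstCaseError S A := by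
    intro g hg hcg
    refine le_trans ?_ (le_iSup₂ (f := fun (f : H) (_ : ‖f‖ ≤ 1) => ‖S f - A f‖ₑ) g hg)
    rw [← ofReal_norm]
    exact ENNReal.ofReal_le_ofReal hcg
  rcases key with h | h
  · exact hfin f hf1.le h
  · exact hfin (-f) (by rw [norm_neg, hf1]) h

/-- The spectral truncation to the indices in `s` is the algorithm; only coefficients with `τ i ≤ c`
remain in the error. -/
theorem exists_isAlgorithm_worstCaseError_le {S : H →L[ℝ] G} (e : HilbertBasis ι ℝ H)
    {τ : ι → ℝ} (hτ : ∀ i, 0 ≤ τ i) {v : ι → G} (hv : Orthonormal ℝ v)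
    (hS : ∀ i, S (e i) = τ i • v i) {c : ℝ} (hc : 0 ≤ c) {s : Finset ι}
    (hs : ∀ i ∉ s, τ i ≤ c) :
    ∃ A : H → G, IsAlgorithm s.card A ∧ worstCaseError S A ≤ ENNReal.ofReal c := by
  classical
  refine ⟨fun f => ∑ i ∈ s, inner ℝ (e i) f • S (e i),
    ⟨fun j => innerSL ℝ (e (s.equivFin.symm j)),
      fun z => ∑ j, z j • S (e (s.equivFin.symm j)), ?_, fun f => ?_⟩,
    worstCaseError_le hc fun f => ?_⟩
  · let : MeasurableSpace G := borel G
    have : BorelSpace G := ⟨rfl⟩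
    exact Continuous.measurable (by fun_prop)
  · beta_reduce
    rw [← Finset.sum_coe_sort, ← s.equivFin.symm.sum_comp]
    rfl
  · have : S f - ∑ i ∈ s, inner ℝ (e i) f • S (e i) =
        S (f - ∑ i ∈ s, inner ℝ (e i) f • e i) := by simp
    rw [this]
    refine norm_apply_le_of_coeff_le e hv hS hc fun i => ?_
    have hi : inner ℝ (e i) (f - ∑ j ∈ s, inner ℝ (e j) f • e j) =
        if i ∈ s then 0 else inner ℝ (e i) f := by
      rw [inner_sub_right, inner_sum]
      simp only [inner_smul_right, orthonormal_iff_ite.mp e.orthonormal, mul_ite, mul_one,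
        mul_zero, Finset.sum_ite_eq]
      split_ifs <;> simp
    rw [hi]
    split_ifs with h
    · simpa using mul_nonneg hc (abs_nonneg _)
    · rw [abs_mul, abs_of_nonneg (hτ i), mul_comm]
      exact mul_le_mul_of_nonneg_right (hs i h) (abs_nonneg _)

theorem minimalError_zero {S : H →L[ℝ] G} (e : HilbertBasis ι ℝ H) {τ : ι → ℝ}
    (hτ : ∀ i, 0 ≤ τ i) {v : ι → G} (hv : Orthonormal ℝ v) (hS : ∀ i, S (e i) = τ i • v i)
    {i₀ : ι} (hmax : ∀ i, τ i ≤ τ i₀) : minimalError S 0 = ENNReal.ofReal (τ i₀) := by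
  rw [minimalError, if_pos rfl]
  refine le_antisymm (worstCaseError_le (hτ i₀) fun f => ?_) ?_
  · rw [Pi.zero_apply, sub_zero]
    refine norm_apply_le_of_coeff_le e hv hS (hτ i₀) fun i => ?_
    rw [abs_mul, abs_of_nonneg (hτ i), mul_comm]
    exact mul_le_mul_of_nonneg_right (hmax i) (abs_nonneg _)
  · exact le_worstCaseError (s := {i₀}) e.orthonormal hv hS (hτ i₀) (by simp) (by simp)
      isAlgorithm_zero

/-- The information complexity of an operator with singular values `τ` for the normalized error
criterion is the number of singular values exceeding `ε` times the largest one. -/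
theorem complexityNOR_eq_encard {S : H →L[ℝ] G} (e : HilbertBasis ι ℝ H) {τ : ι → ℝ}
    (hτ : ∀ i, 0 < τ i) {v : ι → G} (hv : Orthonormal ℝ v) (hS : ∀ i, S (e i) = τ i • v i)
    {i₀ : ι} (hmax : ∀ i, τ i ≤ τ i₀) {ε : ℝ} (hε : 0 < ε) (hε1 : ε < 1)
    (hfin : {i | ε * τ i₀ < τ i}.Finite) :
    complexityNOR S ε = {i | ε * τ i₀ < τ i}.encard := by
  have hτ0 : ∀ i, 0 ≤ τ i := fun i => (hτ i).le
  set s := hfin.toFinset with hs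
  have hmem : ∀ i, i ∈ s ↔ ε * τ i₀ < τ i := fun i => by simp [hs]
  have hi₀ : i₀ ∈ s := (hmem _).mpr (mul_lt_of_lt_one_left (hτ i₀) hε1)
  rw [hfin.encard_eq_coe_toFinset_card, complexityNOR, minimalError_zero e hτ0 hv hS hmax,
    ← ENNReal.ofReal_mul hε.le]
  refine le_antisymm (iInf₂_le s.card ?_) (le_iInf₂ fun n hn => ?_)
  · rw [minimalError, if_neg (Finset.card_ne_zero_of_mem hi₀)]
    obtain ⟨A, hA, hle⟩ := exists_isAlgorithm_worstCaseError_le e hτ0 hv hS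
      (c := ε * τ i₀) (by have := hτ i₀; positivity) (s := s)
      fun i hi => not_lt.mp fun h => hi ((hmem i).mpr h)
    exact (iInf₂_le A hA).trans hle
  · by_contra! hlt
    replace hlt : n < s.card := by exact_mod_cast hlt
    -- The smallest singular value in `s` still exceeds `ε * τ i₀` strictly, and no algorithm with
    -- fewer than `s.card` functionals has error below it.
    obtain ⟨j, hj, hjmin⟩ := s.exists_min_image τ ⟨i₀, hi₀⟩
    have hlow : ENNReal.ofReal (τ j) ≤ minimalError S n := by
      have key := fun (A : H → G) (hA : IsAlgorithm n A) =>
        le_worstCaseError e.orthonormal hv hS (hτ0 j) hjmin hlt hA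
      rw [minimalError]
      -- The case `n = 0` is separate because `minimalError` then allows only the zero algorithm.
      split_ifs with h
      · subst h; exact key 0 isAlgorithm_zero
      · exact le_iInf₂ key
    exact absurd (hlow.trans hn) (not_le.mpr
      ((ENNReal.ofReal_lt_ofReal_iff (hτ j)).mpr ((hmem j).mp hj)))

end SingularValues


/-! ### Mercer expansions: composition and tensor products. -/

theorem hasSum_fin_prod {d : ℕ} {f : Fin d → ℕ → ℝ} {a : Fin d → ℝ}
    (hf : ∀ k, HasSum (f k) (a k)) :
    HasSum (fun m : Fin d → ℕ => ∏ k, f k (m k)) (∏ k, a k) := by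
  induction d with
  | zero => simp
  | succ d ih =>
    have h1 := ih (f := fun k => f k.succ) (a := fun k => a k.succ) fun k => hf k.succ
    set g : (Fin d → ℕ) → ℝ := fun m => ∏ k, f k.succ (m k) with hg
    have s1 : Summable fun x => ‖f 0 x‖ := (hf 0).summable.norm
    have s2 : Summable fun x => ‖g x‖ := h1.summable.norm
    have h2 := (hf 0).mul h1 (summable_mul_of_summable_norm s1 s2)
    rw [Fin.prod_univ_succ, ← (Fin.consEquiv fun _ : Fin (d + 1) => ℕ).hasSum_iff]
    have e : (fun m : Fin (d + 1) → ℕ => ∏ k, f k (m k)) ∘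
        (Fin.consEquiv fun _ : Fin (d + 1) => ℕ) =
          fun p : ℕ × (Fin d → ℕ) => f 0 p.1 * ∏ k, f k.succ (p.2 k) := by
      ext p
      simp [Fin.prod_univ_succ, Fin.consEquiv]
    rw [e]
    exact h2

/-- A kernel given by an absolutely convergent series `∑ i, lam i * ψ i x * ψ i y` with a uniformly
bounded orthonormal system `ψ` of continuous functions. -/
structure IsMercerExpansion {X ι : Type*} [TopologicalSpace X] [MeasureSpace X]
    (K : X → X → ℝ) (lam : ι → ℝ) (ψ : ι → X → ℝ) : Prop where
  pos : ∀ i, 0 < lam i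
  summable : Summable lam
  continuous : ∀ i, Continuous (ψ i)
  bounded : ∃ M, ∀ i x, |ψ i x| ≤ M
  orthonormal : ∀ i, ∫ x, ψ i x * ψ i x = 1
  orthogonal : ∀ i j, i ≠ j → ∫ x, ψ i x * ψ j x = 0
  hasSum : ∀ x y, HasSum (fun i => lam i * ψ i x * ψ i y) (K x y)

namespace IsMercerExpansion

variable {X ι : Type*} [TopologicalSpace X] [CompactSpace X] [MeasureSpace X]
  [OpensMeasurableSpace X] [IsProbabilityMeasure (volume : Measure X)] [Countable ι]
  {K K' : X → X → ℝ} {lam lam' : ι → ℝ} {ψ : ι → X → ℝ}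

/-- Termwise integration is legitimate because the terms are dominated by `lam i * (M * M * C)`,
which is summable. This is where uniform boundedness of `ψ` is needed. -/
theorem hasSum_integral_mul (h : IsMercerExpansion K lam ψ) {g : X → ℝ} (hg : Continuous g)
    (x : X) : HasSum (fun i => lam i * ψ i x * ∫ s, ψ i s * g s) (∫ s, K x s * g s) := by
  obtain ⟨M, hM⟩ := h.bounded
  obtain ⟨C, hC⟩ := (isCompact_univ.image hg).isBounded.exists_norm_le
  have hC' : ∀ s, |g s| ≤ C := fun s => hC _ ⟨s, Set.mem_univ s, rfl⟩
  have hint : ∀ i, Integrable fun s => lam i * ψ i x * ψ i s * g s := fun i =>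
    integrable_of_continuous (by have := h.continuous i; fun_prop)
  have hb : ∀ i s, ‖lam i * ψ i x * ψ i s * g s‖ ≤ lam i * (M * M * C) := fun i s => by
    have hM0 : 0 ≤ M := (abs_nonneg _).trans (hM i s)
    rw [Real.norm_eq_abs, abs_mul, abs_mul, abs_mul, abs_of_pos (h.pos i), mul_assoc, mul_assoc]
    refine mul_le_mul_of_nonneg_left ?_ (h.pos i).le
    rw [mul_assoc]
    gcongr
    exacts [hM i x, hM i s, hC' s]
  have key := hasSum_integral_of_summable_integral_norm hint ?_
  · have e1 : ∀ i, ∫ s, lam i * ψ i x * ψ i s * g s = lam i * ψ i x * ∫ s, ψ i s * g s := by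
      intro i
      rw [← integral_const_mul]
      simp only [mul_assoc]
    have e2 : ∀ s, ∑' i, lam i * ψ i x * ψ i s * g s = K x s * g s := fun s =>
      ((h.hasSum x s).mul_right (g s)).tsum_eq
    simpa only [e1, e2] using key
  · refine Summable.of_nonneg_of_le (fun i => integral_nonneg fun s => norm_nonneg _) (fun i => ?_)
      (h.summable.mul_right (M * M * C))
    refine (integral_mono (hint i).norm (integrable_const _) (hb i)).trans ?_
    simp

theorem integral_kernel_mul (h : IsMercerExpansion K lam ψ) (i : ι) (x : X) :
    ∫ s, K x s * ψ i s = lam i * ψ i x := by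
  have h1 := h.hasSum_integral_mul (h.continuous i) x
  refine h1.unique ?_
  convert hasSum_single i fun j hj => ?_ using 1
  · rw [h.orthonormal, mul_one]
  · rw [h.orthogonal j i hj, mul_zero]

/-- Integral operators with common eigenfunctions compose by multiplying eigenvalues: the
coefficients of `K' · y` are `lam' i * ψ i y` by the eigenvalue equation. Summability holds since
each `lam' i` is at most the sum of all. -/
theorem comp (h : IsMercerExpansion K lam ψ) (h' : IsMercerExpansion K' lam' ψ)
    (hK' : ∀ y, Continuous fun x => K' x y) :
    IsMercerExpansion (fun x y => ∫ s, K x s * K' s y) (fun i => lam i * lam' i) ψ where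
  pos i := mul_pos (h.pos i) (h'.pos i)
  summable := by
    refine Summable.of_nonneg_of_le (fun i => (mul_pos (h.pos i) (h'.pos i)).le) (fun i => ?_)
      (h.summable.mul_right (∑' j, lam' j))
    exact mul_le_mul_of_nonneg_left (h'.summable.le_tsum i fun j _ => (h'.pos j).le) (h.pos i).le
  continuous := h.continuous
  bounded := h.bounded
  orthonormal := h.orthonormal
  orthogonal := h.orthogonal
  hasSum x y := by
    convert h.hasSum_integral_mul (hK' y) x using 1
    ext i
    have : ∫ s, ψ i s * K' s y = lam' i * ψ i y := by
      rw [← h'.integral_kernel_mul i y]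
      congr 1; ext s
      -- Symmetry of `K'` is read off from its expansion.
      rw [mul_comm, (h'.hasSum s y).unique (by
        simpa only [mul_right_comm] using h'.hasSum y s)]
    rw [this]; ring

omit [CompactSpace X] [OpensMeasurableSpace X] in
-- The properties of `ψ` are separate arguments because the family `h` is empty when `d = 0`.
theorem pi {d : ℕ} {K : Fin d → X → X → ℝ} {lam : Fin d → ℕ → ℝ} {ψ : ℕ → X → ℝ}
    (h : ∀ k, IsMercerExpansion (K k) (lam k) ψ)
    (hψ : ∃ M, ∀ i x, |ψ i x| ≤ M)
    (hc : ∀ i, Continuous (ψ i)) (ho : ∀ i, ∫ x, ψ i x * ψ i x = 1)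
    (ho' : ∀ i j, i ≠ j → ∫ x, ψ i x * ψ j x = 0) :
    IsMercerExpansion (fun x y : Fin d → X => ∏ k, K k (x k) (y k))
      (fun m : Fin d → ℕ => ∏ k, lam k (m k)) (fun m x => ∏ k, ψ (m k) (x k)) where
  pos m := Finset.prod_pos fun k _ => (h k).pos _
  summable := (hasSum_fin_prod fun k => (h k).summable.hasSum).summable
  continuous m := continuous_finsetProd _ fun k _ => (hc (m k)).comp (continuous_apply k)
  bounded := by
    obtain ⟨M, hM⟩ := hψ
    refine ⟨∏ _k : Fin d, M, fun m x => ?_⟩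
    rw [Finset.abs_prod]
    exact Finset.prod_le_prod (fun _ _ => abs_nonneg _) fun _ _ => hM _ _
  orthonormal m := by
    simp_rw [← Finset.prod_mul_distrib]
    rw [integral_fintype_prod_volume_eq_prod fun (k : Fin d) (u : X) => ψ (m k) u * ψ (m k) u]
    simp [ho]
  orthogonal m n hmn := by
    obtain ⟨k, hk⟩ := Function.ne_iff.mp hmn
    simp_rw [← Finset.prod_mul_distrib]
    rw [integral_fintype_prod_volume_eq_prod fun (k : Fin d) (u : X) => ψ (m k) u * ψ (n k) u]
    exact Finset.prod_eq_zero (Finset.mem_univ k) (ho' _ _ hk)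
  hasSum x y := by
    have := hasSum_fin_prod fun k => (h k).hasSum (x k) (y k)
    simpa only [Finset.prod_mul_distrib] using this

end IsMercerExpansion

/-! ### Eigenpairs of the Euler kernels. -/

/-- The eigenfunctions `√2 sin((j + 1/2) π x)` of the integral operator with kernel `min(x, y)`. -/
def sineBasis (j : ℕ) (x : I) : ℝ := √2 * Real.sin ((2 * j + 1) * (Real.pi / 2) * x)

/-- The eigenvalues `(2 / ((2 j + 1) π))²` of the integral operator with kernel `min(x, y)`. -/
def sineEigenvalue (j : ℕ) : ℝ := (2 / ((2 * j + 1) * Real.pi)) ^ 2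

/-- The odd part of the Fourier series of the second Bernoulli polynomial. The full series at `u/4`
splits into odd and even terms, and its even terms are a quarter of the full series at `u/2`;
subtracting leaves a linear function of `u`. -/
theorem hasSum_odd_cos {u : ℝ} (h0 : 0 ≤ u) (h2 : u ≤ 2) :
    HasSum (fun j : ℕ => 1 / (2 * (j : ℝ) + 1) ^ 2 * Real.cos ((2 * j + 1) * (Real.pi / 2) * u))
      (Real.pi ^ 2 / 8 * (1 - u)) := by
  have hB : ∀ t : ℝ, ((-1 : ℝ) ^ (1 + 1) * (2 * Real.pi) ^ (2 * 1) / 2 / (Nat.factorial (2 * 1)) *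
        (Polynomial.map (algebraMap ℚ ℝ) (Polynomial.bernoulli (2 * 1))).eval t) =
        Real.pi ^ 2 * (t ^ 2 - t + 1 / 6) := by
    intro t
    have : Polynomial.bernoulli (2 * 1) =
        Polynomial.X ^ 2 - Polynomial.X + Polynomial.C (6⁻¹ : ℚ) := by
      rw [mul_one, Polynomial.bernoulli_def]
      simp [Finset.sum_range_succ, ← Polynomial.C_mul_X_pow_eq_monomial, bernoulli_one,
        bernoulli_two]
      have : (Polynomial.C (1 / 2 : ℚ)) * 2 = 1 := by
        rw [← Polynomial.C_ofNat, ← map_mul]; norm_num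
      norm_num
      linear_combination -Polynomial.X * this
    rw [this]
    simp only [Nat.factorial, Polynomial.map_add, Polynomial.map_sub, Polynomial.map_pow,
      Polynomial.map_X, Polynomial.map_C, Polynomial.eval_add, Polynomial.eval_sub,
      Polynomial.eval_pow, Polynomial.eval_X, Polynomial.eval_C]
    have h6 : algebraMap ℚ ℝ 6⁻¹ = 1 / 6 := by simp
    rw [h6]
    push_cast
    ring
  have hA := hasSum_one_div_nat_pow_mul_cos one_ne_zero (x := u / 4) ⟨by linarith, by linarith⟩
  have hE := hasSum_one_div_nat_pow_mul_cos one_ne_zero (x := u / 2) ⟨by linarith, by linarith⟩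
  rw [hB] at hA hE
  set f : ℕ → ℝ := fun n => 1 / (n : ℝ) ^ (2 * 1) * Real.cos (2 * Real.pi * n * (u / 4))
  have hE' : HasSum (fun j => f (2 * j))
      (1 / 4 * (Real.pi ^ 2 * ((u / 2) ^ 2 - u / 2 + 1 / 6))) := by
    refine (hE.mul_left (1 / 4)).congr_fun fun j => ?_
    simp only [f]
    push_cast
    have e1 : 2 * Real.pi * (2 * (j : ℝ)) * (u / 4) = 2 * Real.pi * j * (u / 2) := by ring
    have e2 : 1 / (2 * (j : ℝ)) ^ (2 * 1) = 1 / 4 * (1 / (j : ℝ) ^ (2 * 1)) := by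
      rw [mul_pow, one_div, mul_inv, one_div, one_div]; norm_num
    rw [e1, e2, mul_assoc]
  have hO : Summable fun j => f (2 * j + 1) :=
    hA.summable.comp_injective fun a b h => by simpa using h
  have hval := (HasSum.even_add_odd hE' hO.hasSum).unique hA
  have : ∑' j, f (2 * j + 1) = Real.pi ^ 2 / 8 * (1 - u) := by linear_combination hval
  rw [← this]
  refine hO.hasSum.congr_fun fun j => ?_
  simp only [f]
  push_cast
  congr 2
  ring

theorem integral_cos_int_mul_pi (k : ℤ) :
    ∫ x : I, Real.cos (k * Real.pi * x) = if k = 0 then 1 else 0 := by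
  split_ifs with h
  · simp [h]
  · have : ∫ x : I, Real.cos (k * Real.pi * x) = ∫ x in (0 : ℝ)..1, Real.cos (k * Real.pi * x) := by
      rw [intervalIntegral.integral_of_le zero_le_one, ← integral_Icc_eq_integral_Ioc]
      exact integral_subtype_comap measurableSet_Icc fun x : ℝ => Real.cos (k * Real.pi * x)
    have hk : (k : ℝ) * Real.pi ≠ 0 := mul_ne_zero (by exact_mod_cast h) Real.pi_ne_zero
    rw [this, intervalIntegral.integral_comp_mul_left _ hk, integral_cos]
    simp [Real.sin_int_mul_pi]

theorem integral_sineBasis_mul (i j : ℕ) :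
    ∫ x, sineBasis i x * sineBasis j x = if i = j then 1 else 0 := by
  have h : ∀ x : I, sineBasis i x * sineBasis j x =
      Real.cos (((i - j : ℤ) : ℝ) * Real.pi * x) -
        Real.cos (((i + j + 1 : ℤ) : ℝ) * Real.pi * x) := by
    intro x
    have e1 : ((i - j : ℤ) : ℝ) * Real.pi * x =
      (2 * i + 1) * (Real.pi / 2) * x - (2 * j + 1) * (Real.pi / 2) * x := by push_cast; ring
    have e2 : ((i + j + 1 : ℤ) : ℝ) * Real.pi * x =
      (2 * i + 1) * (Real.pi / 2) * x + (2 * j + 1) * (Real.pi / 2) * x := by push_cast; ring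
    rw [e1, e2, Real.cos_sub, Real.cos_add, sineBasis, sineBasis]
    linear_combination Real.sin ((2 * i + 1) * (Real.pi / 2) * x) *
      Real.sin ((2 * j + 1) * (Real.pi / 2) * x) * Real.mul_self_sqrt (zero_le_two (α := ℝ))
  simp_rw [h]
  rw [integral_sub (integrable_of_continuous (by fun_prop))
    (integrable_of_continuous (by fun_prop)), integral_cos_int_mul_pi, integral_cos_int_mul_pi,
    -- The sum frequency `i + j + 1` never vanishes, so only the difference frequency contributes.
    if_neg (by lia : ¬ (i + j + 1 : ℤ) = 0), sub_zero]
  simp [sub_eq_zero]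

theorem continuous_sineBasis (j : ℕ) : Continuous (sineBasis j) := by
  unfold sineBasis; fun_prop

theorem abs_sineBasis_le (j : ℕ) (x : I) : |sineBasis j x| ≤ √2 := by
  rw [sineBasis, abs_mul, abs_of_nonneg (Real.sqrt_nonneg 2)]
  exact mul_le_of_le_one_right (Real.sqrt_nonneg 2) (Real.abs_sin_le_one _)

theorem sineEigenvalue_pos (j : ℕ) : 0 < sineEigenvalue j := by
  have := Real.pi_pos
  unfold sineEigenvalue; positivity

/-- Since `min x y = ((x + y) - |x - y|) / 2` and `2 sin a sin b = cos (a - b) - cos (a + b)`, the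
expansion is the difference of `hasSum_odd_cos` at `|x - y|` and at `x + y`, both in `[0, 2]`. -/
theorem isMercerExpansion_min :
    IsMercerExpansion (fun x y : I => ((min x y : I) : ℝ)) sineEigenvalue sineBasis where
  pos := sineEigenvalue_pos
  summable := by
    have := (hasSum_odd_cos le_rfl zero_le_two).summable.mul_left (4 / Real.pi ^ 2)
    refine this.congr fun j => ?_
    rw [sineEigenvalue, mul_zero, Real.cos_zero]
    field_simp
    norm_num
  continuous := continuous_sineBasis
  bounded := ⟨√2, abs_sineBasis_le⟩
  orthonormal i := by simp [integral_sineBasis_mul]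
  orthogonal i j hij := by simp [integral_sineBasis_mul, hij]
  hasSum x y := by
    have hx := x.2
    have hy := y.2
    have h1 := hasSum_odd_cos (u := |(x : ℝ) - y|) (abs_nonneg _)
      (abs_le.mpr ⟨by linarith [hx.1, hy.2], by linarith [hx.2, hy.1]⟩)
    have h2 := hasSum_odd_cos (u := x + y) (add_nonneg hx.1 hy.1) (by linarith [hx.2, hy.2])
    have hpi := Real.pi_ne_zero
    have h3 := (h1.sub h2).mul_left (4 / Real.pi ^ 2)
    have hval : ((min x y : I) : ℝ) = 4 / Real.pi ^ 2 *
        (Real.pi ^ 2 / 8 * (1 - |(x : ℝ) - y|) - Real.pi ^ 2 / 8 * (1 - (x + y))) := by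
      have : ((min x y : I) : ℝ) = min (x : ℝ) y := by
        rcases le_total x y with h | h <;> simp [h]
      rw [this]
      rcases le_total (x : ℝ) y with h | h
      · rw [min_eq_left h, abs_of_nonpos (by linarith)]; field_simp; ring
      · rw [min_eq_right h, abs_of_nonneg (by linarith)]; field_simp; ring
    rw [hval]
    refine h3.congr_fun fun j => ?_
    · have e : Real.cos ((2 * j + 1) * (Real.pi / 2) * |(x : ℝ) - y|) =
          Real.cos ((2 * j + 1) * (Real.pi / 2) * x - (2 * j + 1) * (Real.pi / 2) * y) := by
        rw [← mul_sub]
        rcases abs_choice ((x : ℝ) - y) with h | h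
        · rw [h]
        · rw [h, mul_neg, Real.cos_neg]
      rw [e, mul_add, Real.cos_sub, Real.cos_add, sineEigenvalue, sineBasis, sineBasis]
      have h2 := Real.sq_sqrt (zero_le_two (α := ℝ))
      have hj : (2 * (j : ℝ) + 1) ≠ 0 := by positivity
      field_simp
      rw [h2]
      ring

theorem isMercerExpansion_eulerKernel (r : ℕ) :
    IsMercerExpansion (eulerKernel r) (fun j => sineEigenvalue j ^ (r + 1)) sineBasis := by
  induction r with
  | zero =>
    convert isMercerExpansion_min using 2
    · ext; exact eulerKernel_zero _ _
    · simp
  | succ r ih =>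
    convert isMercerExpansion_min.comp ih fun y =>
      (continuous_eulerKernel r).comp (continuous_id.prodMk continuous_const) using 2
    · ext; exact eulerKernel_succ _ _ _
    · rw [pow_succ']

theorem isMercerExpansion_tensorEulerKernel (r : ℕ → ℕ) (d : ℕ) :
    IsMercerExpansion (tensorEulerKernel r d)
      (fun m : Fin d → ℕ => ∏ k : Fin d, sineEigenvalue (m k) ^ (r (k + 1) + 1))
      (fun m x => ∏ k, sineBasis (m k) (x k)) :=
  IsMercerExpansion.pi (fun k : Fin d => isMercerExpansion_eulerKernel (r (k + 1)))
    ⟨√2, abs_sineBasis_le⟩ continuous_sineBasis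
    (fun i => isMercerExpansion_min.orthonormal i) isMercerExpansion_min.orthogonal


/-! ### Singular system of the embedding. -/

section Eigenbasis

variable {r : ℕ → ℕ} {d : ℕ}

theorem inner_kerFun_one (x : Fin d → I) (f : EulerSpace r d) :
    inner ℝ (RKHS.kerFun (EulerSpace r d) x 1) f = f x := by
  rw [RKHS.kerFun_inner]; simp

theorem kerFun_one_apply (x y : Fin d → I) :
    RKHS.kerFun (EulerSpace r d) x 1 y = tensorEulerKernel r d y x := by
  rw [RKHS.kerFun_apply, RKHS.OfKernel.kernel_ofKernel]
  simp [eulerMatrix]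

variable {ι : Type*} [Countable ι] {lam : ι → ℝ} {ψ : ι → (Fin d → I) → ℝ}

/-- The class in `L₂` of the `i`-th function of a Mercer expansion. -/
def mercerL2 (h : IsMercerExpansion (tensorEulerKernel r d) lam ψ) (i : ι) :
    Lp ℝ 2 (volume : Measure (Fin d → I)) :=
  ContinuousMap.toLp 2 volume ℝ ⟨ψ i, h.continuous i⟩

omit [Countable ι] in
theorem orthonormal_mercerL2 (h : IsMercerExpansion (tensorEulerKernel r d) lam ψ) :
    Orthonormal ℝ (mercerL2 h) := by
  classical
  rw [orthonormal_iff_ite]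
  intro i j
  rw [mercerL2, mercerL2, ContinuousMap.inner_toLp]
  simp only [ContinuousMap.coe_mk, conj_trivial]
  split_ifs with hij
  · subst hij; exact h.orthonormal i
  · simpa only [mul_comm] using h.orthogonal i j hij

/-- By the reproducing property, evaluating the adjoint at `x` is an `L₂` pairing with the kernel
section at `x`, to which the eigenvalue equation applies. -/
theorem adjoint_APP_mercerL2_apply (h : IsMercerExpansion (tensorEulerKernel r d) lam ψ) (i : ι)
    (x : Fin d → I) : (APP r d).adjoint (mercerL2 h i) x = lam i * ψ i x := by
  rw [← inner_kerFun_one, ContinuousLinearMap.adjoint_inner_right, ← h.integral_kernel_mul i x]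
  simp only [APP, ContinuousLinearMap.comp_apply, mercerL2]
  rw [ContinuousMap.inner_toLp]
  refine integral_congr_ae (Filter.Eventually.of_forall fun s => ?_)
  have : toContinuousMap r d (RKHS.kerFun (EulerSpace r d) x 1) s = tensorEulerKernel r d s x :=
    kerFun_one_apply x s
  simp only [ContinuousMap.coe_mk, conj_trivial, this]
  rw [mul_comm, (h.hasSum x s).unique (by simpa only [mul_right_comm] using h.hasSum s x)]

theorem APP_adjoint_APP_mercerL2 (h : IsMercerExpansion (tensorEulerKernel r d) lam ψ) (i : ι) :
    APP r d ((APP r d).adjoint (mercerL2 h i)) = lam i • mercerL2 h i := by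
  rw [mercerL2, ← map_smul, ← mercerL2, APP, ContinuousLinearMap.comp_apply]
  congr 1
  ext x
  exact adjoint_APP_mercerL2_apply h i x

/-- The orthonormal basis of `H(K_{d,r})` consisting of normalized eigenfunctions. -/
def mercerFun (h : IsMercerExpansion (tensorEulerKernel r d) lam ψ) (i : ι) : EulerSpace r d :=
  (√(lam i))⁻¹ • (APP r d).adjoint (mercerL2 h i)

theorem APP_mercerFun (h : IsMercerExpansion (tensorEulerKernel r d) lam ψ) (i : ι) :
    APP r d (mercerFun h i) = √(lam i) • mercerL2 h i := by
  rw [mercerFun, map_smul, APP_adjoint_APP_mercerL2, smul_smul, inv_mul_eq_div, Real.div_sqrt]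

theorem orthonormal_mercerFun (h : IsMercerExpansion (tensorEulerKernel r d) lam ψ) :
    Orthonormal ℝ (mercerFun h) := by
  classical
  rw [orthonormal_iff_ite]
  intro i j
  rw [mercerFun, inner_smul_left, ContinuousLinearMap.adjoint_inner_left, APP_mercerFun,
    inner_smul_right, orthonormal_iff_ite.mp (orthonormal_mercerL2 h)]
  have := Real.sqrt_pos.mpr (h.pos i)
  split_ifs with hij
  · subst hij
    simp only [conj_trivial]
    field_simp
  · simp

theorem inner_mercerFun_kerFun (h : IsMercerExpansion (tensorEulerKernel r d) lam ψ) (i : ι)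
    (x : Fin d → I) :
    inner ℝ (mercerFun h i) (RKHS.kerFun (EulerSpace r d) x 1) = √(lam i) * ψ i x := by
  rw [real_inner_comm, inner_kerFun_one, mercerFun, RKHS.coe_smul, Pi.smul_apply,
    adjoint_APP_mercerL2_apply, smul_eq_mul, ← mul_assoc, inv_mul_eq_div, Real.div_sqrt]

/-- Completeness comes from pointwise convergence on the diagonal. The partial sums `p s` of the
kernel section `k` satisfy `‖k - p s‖² = K(x,x) - ∑ lam i * ψ i x ^ 2`, which tends to 0. If `f` is
orthogonal to the system, then `f x = ⟪k - p s, f⟫` for every `s`, hence `f x = 0`. -/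
theorem orthogonal_span_mercerFun (h : IsMercerExpansion (tensorEulerKernel r d) lam ψ) :
    (Submodule.span ℝ (Set.range (mercerFun h)))ᗮ = ⊥ := by
  rw [Submodule.eq_bot_iff]
  intro f hf
  have hf0 : ∀ i, inner ℝ (mercerFun h i) f = 0 := fun i =>
    (Submodule.mem_orthogonal _ _).mp hf _ (Submodule.subset_span ⟨i, rfl⟩)
  refine RKHS.ext (𝕜 := ℝ) fun x => ?_
  set k := RKHS.kerFun (EulerSpace r d) x 1 with hk
  set p : Finset ι → EulerSpace r d :=
    fun s => ∑ i ∈ s, (√(lam i) * ψ i x) • mercerFun h i with hp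
  have hnorm : ∀ s, ‖k - p s‖ ^ 2 =
      tensorEulerKernel r d x x - ∑ i ∈ s, lam i * ψ i x * ψ i x := by
    intro s
    have h1 : inner ℝ k (p s) = ∑ i ∈ s, lam i * ψ i x * ψ i x := by
      rw [hp, inner_sum]
      refine Finset.sum_congr rfl fun i _ => ?_
      rw [inner_smul_right, real_inner_comm, hk, inner_mercerFun_kerFun]
      linear_combination ψ i x ^ 2 * Real.mul_self_sqrt (h.pos i).le
    have h2 : ‖p s‖ ^ 2 = ∑ i ∈ s, lam i * ψ i x * ψ i x := by
      rw [hp, norm_sq_sum_smul (orthonormal_mercerFun h)]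
      refine Finset.sum_congr rfl fun i _ => ?_
      linear_combination ψ i x ^ 2 * Real.sq_sqrt (h.pos i).le
    have h3 : ‖k‖ ^ 2 = tensorEulerKernel r d x x := by
      rw [← real_inner_self_eq_norm_sq, hk, inner_kerFun_one, kerFun_one_apply]
    rw [norm_sub_sq_real, h1, h2, h3]
    ring
  have hle : ∀ s, |f x| ≤
      √(tensorEulerKernel r d x x - ∑ i ∈ s, lam i * ψ i x * ψ i x) * ‖f‖ := by
    intro s
    have hps : inner ℝ (p s) f = 0 := by
      rw [hp, sum_inner]
      exact Finset.sum_eq_zero fun i _ => by rw [inner_smul_left, hf0, mul_zero]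
    rw [← hnorm, Real.sqrt_sq (norm_nonneg _), ← inner_kerFun_one x f, ← hk,
      ← sub_zero (inner ℝ k f), ← hps, ← inner_sub_left]
    exact abs_real_inner_le_norm _ _
  have hlim : Filter.Tendsto (fun s : Finset ι =>
      √(tensorEulerKernel r d x x - ∑ i ∈ s, lam i * ψ i x * ψ i x) * ‖f‖) Filter.atTop
      (nhds 0) := by
    have h1 : Filter.Tendsto (fun s : Finset ι => ∑ i ∈ s, lam i * ψ i x * ψ i x) Filter.atTop
      (nhds (tensorEulerKernel r d x x)) := h.hasSum x x
    simpa using ((h1.const_sub (tensorEulerKernel r d x x)).sqrt).mul_const ‖f‖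
  have := ge_of_tendsto hlim (Filter.Eventually.of_forall hle)
  rw [RKHS.coe_zero (𝕜 := ℝ), Pi.zero_apply]
  exact abs_nonpos_iff.mp this

/-- The Hilbert basis of `H(K_{d,r})` consisting of normalized eigenfunctions. -/
def mercerBasis (h : IsMercerExpansion (tensorEulerKernel r d) lam ψ) :
    HilbertBasis ι ℝ (EulerSpace r d) :=
  HilbertBasis.mkOfOrthogonalEqBot (orthonormal_mercerFun h) (orthogonal_span_mercerFun h)

end Eigenbasis

/-! ### Reduction to counting multi-indices. -/

/-- The multi-indices `m` with `∏ (2 m_k + 1) ^ (r_k + 1) < X`. -/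
def oddIndices (r : ℕ → ℕ) (d : ℕ) (X : ℝ) : Set (Fin d → ℕ) :=
  {m | ∏ k : Fin d, (2 * (m k : ℝ) + 1) ^ (r (k + 1) + 1) < X}

theorem one_le_odd_pow (m a : ℕ) : 1 ≤ (2 * (m : ℝ) + 1) ^ a :=
  one_le_pow₀ (by linarith [(Nat.cast_nonneg m : (0 : ℝ) ≤ m)])

theorem finite_oddIndices (r : ℕ → ℕ) (d : ℕ) (X : ℝ) : (oddIndices r d X).Finite := by
  refine (Set.Finite.pi' fun _ : Fin d => Set.finite_Iic ⌊X⌋₊).subset fun m hm k => ?_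
  have hm' : ∏ k : Fin d, (2 * (m k : ℝ) + 1) ^ (r (k + 1) + 1) < X := hm
  have h1 : (2 * (m k : ℝ) + 1) ^ (r (k + 1) + 1) ≤
      ∏ k : Fin d, (2 * (m k : ℝ) + 1) ^ (r (k + 1) + 1) := by
    rw [← Finset.mul_prod_erase _ _ (Finset.mem_univ k)]
    exact le_mul_of_one_le_right (by positivity) (Finset.one_le_prod fun _ _ => one_le_odd_pow _ _)
  have h2 : 2 * (m k : ℝ) + 1 ≤ (2 * (m k : ℝ) + 1) ^ (r (k + 1) + 1) :=
    le_self_pow₀ (by linarith [(Nat.cast_nonneg (m k) : (0 : ℝ) ≤ m k)]) (Nat.succ_ne_zero _)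
  exact Nat.le_floor (by linarith [(Nat.cast_nonneg (m k) : (0 : ℝ) ≤ m k)])

/-- The singular values are `c / P m`, largest at `m = 0` where `P 0 = 1`. The factor `c` collecting
the powers of `2/π` cancels, so `ε * τ 0 < τ m` becomes `P m < ε⁻¹`. -/
theorem eulerComplexity_eq_encard (r : ℕ → ℕ) (d : ℕ) {ε : ℝ} (hε : 0 < ε) (hε1 : ε < 1) :
    eulerComplexity r ε d = (oddIndices r d ε⁻¹).encard := by
  have h := isMercerExpansion_tensorEulerKernel r d
  set c : ℝ := ∏ k : Fin d, (2 / Real.pi) ^ (r (k + 1) + 1) with hc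
  set P : (Fin d → ℕ) → ℝ := fun m => ∏ k : Fin d, (2 * (m k : ℝ) + 1) ^ (r (k + 1) + 1) with hP
  have hc0 : 0 < c := Finset.prod_pos fun k _ => by have := Real.pi_pos; positivity
  have hP1 : ∀ m, 1 ≤ P m := fun m => Finset.one_le_prod fun _ _ => one_le_odd_pow _ _
  have hsqrt : ∀ m : Fin d → ℕ,
      √(∏ k : Fin d, sineEigenvalue (m k) ^ (r (k + 1) + 1)) = c / P m := by
    intro m
    rw [Real.sqrt_eq_iff_mul_self_eq (Finset.prod_nonneg fun k _ => 
      pow_nonneg (sineEigenvalue_pos _).le _) (div_nonneg hc0.le (zero_le_one.trans (hP1 m))), hc,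
      hP, ← Finset.prod_div_distrib, ← Finset.prod_mul_distrib]
    refine Finset.prod_congr rfl fun k _ => ?_
    rw [← div_pow, ← mul_pow, sineEigenvalue]
    congr 1
    have := Real.pi_pos
    field_simp
  have hP0 : P 0 = 1 := by simp [hP]
  have hset : {m : Fin d → ℕ | ε * (c / P 0) < c / P m} = oddIndices r d ε⁻¹ := by
    ext m
    have hPm := zero_lt_one.trans_le (hP1 m)
    change ε * (c / P 0) < c / P m ↔ P m < ε⁻¹
    rw [hP0, div_one, lt_div_iff₀ hPm, lt_inv_comm₀ hPm hε, ← one_div, lt_div_iff₀ hPm]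
    constructor <;> intro h <;> nlinarith
  rw [← hset]
  refine complexityNOR_eq_encard (mercerBasis h) (i₀ := 0) (τ := fun m => c / P m)
    (fun m => div_pos hc0 (zero_lt_one.trans_le (hP1 m))) (orthonormal_mercerL2 h) (fun m => ?_)
    (fun m => ?_) hε hε1 ?_
  · rw [mercerBasis, HilbertBasis.coe_mkOfOrthogonalEqBot, APP_mercerFun, hsqrt]
  · exact div_le_div_of_nonneg_left hc0.le (by rw [hP0]; exact one_pos) (hP0 ▸ hP1 m)
  · exact hset ▸ finite_oddIndices r d ε⁻¹


theorem eulerComplexity_le_iff (r : ℕ → ℕ) (d : ℕ) {ε y : ℝ} (hε : 0 < ε) (hε1 : ε < 1)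
    (hy : 0 ≤ y) : (eulerComplexity r ε d : ℝ≥0∞) ≤ ENNReal.ofReal y ↔
      ((oddIndices r d ε⁻¹).ncard : ℝ) ≤ y := by
  rw [eulerComplexity_eq_encard r d hε hε1, ← (finite_oddIndices r d ε⁻¹).cast_ncard_eq,
    ENat.toENNReal_coe, ← ENNReal.ofReal_natCast, ENNReal.ofReal_le_ofReal_iff hy]

/-! ### Upper and lower bounds for the count. -/

/-- For `j ≥ 1` pull out `3^(-s)`; the remaining base `(2j+1)/3` is at least 1, so its exponent may
be replaced by `-s₁`. Thus `C` is uniform in `s ≥ s₁`. The majorant `g` has an exact sum, convenient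
for taking products over coordinates. -/
theorem exists_forall_rpow_le_hasSum {s₁ : ℝ} (hs₁ : 1 < s₁) : ∃ C : ℝ, 0 ≤ C ∧ ∀ s, s₁ ≤ s →
    ∃ g : ℕ → ℝ, (∀ j : ℕ, (2 * (j : ℝ) + 1) ^ (-s) ≤ g j) ∧
      HasSum g (1 + C * (3 : ℝ) ^ (-s)) := by
  set c : ℕ → ℝ := fun j => ((2 * (j : ℝ) + 3) / 3) ^ (-s₁) with hc
  have hcs : Summable c := by
    have h1 : Summable fun n : ℕ => (n : ℝ) ^ (-s₁) := Real.summable_nat_rpow.mpr (by linarith)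
    have h2 := (h1.comp_injective (i := fun j : ℕ => 2 * j + 3) fun a b h => by
      simpa using h).mul_right ((3 : ℝ) ^ (-s₁))⁻¹
    refine h2.congr fun j => ?_
    rw [hc]
    beta_reduce
    rw [Real.div_rpow (by positivity) (by positivity), div_eq_mul_inv]
    simp
  refine ⟨∑' j, c j, tsum_nonneg fun j => by positivity, fun s hs => ?_⟩
  refine ⟨fun j => Nat.casesOn j 1 fun i => c i * (3 : ℝ) ^ (-s), fun j => ?_, ?_⟩
  · cases j with
    | zero => simp
    | succ i =>
      have h3 : (2 * ((i + 1 : ℕ) : ℝ) + 1) = (2 * (i : ℝ) + 3) / 3 * 3 := by push_cast; ring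
      rw [h3, Real.mul_rpow (by positivity) (by positivity)]
      refine mul_le_mul_of_nonneg_right ?_ (by positivity)
      refine Real.rpow_le_rpow_of_exponent_le ?_ (neg_le_neg hs)
      linarith [(Nat.cast_nonneg i : (0 : ℝ) ≤ i)]
  · rw [← hasSum_nat_add_iff' 1]
    simpa using hcs.hasSum.mul_right ((3 : ℝ) ^ (-s))

/-- Upper bound for the number of multi-indices by a Dirichlet series comparison. -/
theorem exists_ncard_oddIndices_le {s₁ : ℝ} (hs₁ : 1 < s₁) : ∃ C : ℝ, 0 ≤ C ∧
    ∀ (r : ℕ → ℕ) (d : ℕ) (X p : ℝ), 0 < X → 0 ≤ p →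
      (∀ k : Fin d, s₁ ≤ p * ((r (k + 1) : ℝ) + 1)) →
      ((oddIndices r d X).ncard : ℝ) ≤
        X ^ p * Real.exp (C * ∑ k : Fin d, (3 : ℝ) ^ (-(p * ((r (k + 1) : ℝ) + 1)))) := by
  obtain ⟨C, hC, hg⟩ := exists_forall_rpow_le_hasSum hs₁
  refine ⟨C, hC, fun r d X p hX hp hk => ?_⟩
  choose g hle hsum using fun k : Fin d => hg _ (hk k)
  have hfin := finite_oddIndices r d X
  have hprod := hasSum_fin_prod hsum
  have hg0 : ∀ k j, 0 ≤ g k j := fun k j => le_trans (by positivity) (hle k j)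
  -- Rankin's trick: a counted index has `1 ≤ (X / P)^p`, and the sum of the majorants over all
  -- indices factorizes over the coordinates.
  have h1 : ∀ m ∈ hfin.toFinset, 1 ≤ X ^ p * ∏ k, g k (m k) := by
    intro m hm
    have hm' : ∏ k : Fin d, (2 * (m k : ℝ) + 1) ^ (r (k + 1) + 1) < X := hfin.mem_toFinset.mp hm
    set P := ∏ k : Fin d, (2 * (m k : ℝ) + 1) ^ (r (k + 1) + 1) with hP
    have hP0 : 0 < P := Finset.prod_pos fun k _ => by positivity
    have h2 : P ^ (-p) ≤ ∏ k, g k (m k) := by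
      rw [hP, ← Real.finsetProd_rpow _ _ fun k _ => by positivity]
      refine Finset.prod_le_prod (fun k _ => by positivity) fun k _ => ?_
      refine le_trans (le_of_eq ?_) (hle k (m k))
      rw [← Real.rpow_natCast, ← Real.rpow_mul (by positivity)]
      congr 1
      push_cast
      ring
    calc (1 : ℝ) = P ^ p * P ^ (-p) := by rw [← Real.rpow_add hP0]; simp
      _ ≤ X ^ p * ∏ k, g k (m k) :=
        mul_le_mul (Real.rpow_le_rpow hP0.le hm'.le hp) h2 (by positivity) (by positivity)
  calc ((oddIndices r d X).ncard : ℝ) = ∑ m ∈ hfin.toFinset, (1 : ℝ) := by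
        rw [Set.ncard_eq_toFinset_card _ hfin]; simp
    _ ≤ ∑ m ∈ hfin.toFinset, X ^ p * ∏ k, g k (m k) := Finset.sum_le_sum h1
    _ ≤ X ^ p * ∏ k : Fin d, (1 + C * (3 : ℝ) ^ (-(p * ((r (k + 1) : ℝ) + 1)))) := by
        rw [← Finset.mul_sum]
        refine mul_le_mul_of_nonneg_left ?_ (by positivity)
        exact sum_le_hasSum _ (fun m _ => Finset.prod_nonneg fun k _ => hg0 _ _) hprod
    _ ≤ _ := by
        refine mul_le_mul_of_nonneg_left ?_ (by positivity)
        rw [Finset.mul_sum, Real.exp_sum]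
        refine Finset.prod_le_prod (fun k _ => by positivity) fun k _ => ?_
        rw [add_comm]
        exact Real.add_one_le_exp _

theorem one_le_ncard_oddIndices (r : ℕ → ℕ) (d : ℕ) {X : ℝ} (hX : 1 < X) :
    1 ≤ (oddIndices r d X).ncard := by
  exact (Set.ncard_pos (finite_oddIndices r d X)).mpr ⟨0, by simpa [oddIndices] using hX⟩

theorem le_ncard_oddIndices_one (r : ℕ → ℕ) (M : ℕ) :
    M ≤ (oddIndices r 1 ((2 * (M : ℝ) + 1) ^ (r 1 + 1))).ncard := by
  have := Set.ncard_le_ncard_of_injOn (s := Set.Iio M)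
    (t := oddIndices r 1 ((2 * (M : ℝ) + 1) ^ (r 1 + 1))) (fun j _ => j) ?_ ?_
    (finite_oddIndices _ _ _)
  · simpa using this
  · intro j hj
    have : (j : ℝ) < M := by exact_mod_cast hj
    simp only [oddIndices, Set.mem_ofPred_eq, Fin.prod_univ_one, Fin.val_zero, zero_add]
    exact pow_lt_pow_left₀ (by linarith) (by positivity) (Nat.succ_ne_zero _)
  · intro i _ j _ h
    exact congrFun h 0

/-- Each `l`-subset of the coordinates gives the index equal to 1 on it and 0 elsewhere; by
monotonicity its product is at most `3^(l(r_d+1))`. -/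
theorem choose_le_ncard_oddIndices {r : ℕ → ℕ} (hr : MonotoneOn r (Set.Ici 1)) (d l : ℕ) {X : ℝ}
    (hX : (3 : ℝ) ^ (l * (r d + 1)) < X) : d.choose l ≤ (oddIndices r d X).ncard := by
  classical
  have := Set.ncard_le_ncard_of_injOn
    (s := ((Finset.univ : Finset (Fin d)).powersetCard l : Set (Finset (Fin d))))
    (t := oddIndices r d X) (fun T k => if k ∈ T then 1 else 0) ?_ ?_ (finite_oddIndices _ _ _)
  · simpa [Set.ncard_coe_finset] using this
  · intro T hT
    have hT' : T.card = l := (Finset.mem_powersetCard.mp hT).2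
    refine lt_of_le_of_lt ?_ hX
    calc ∏ k : Fin d, (2 * ((if k ∈ T then 1 else 0 : ℕ) : ℝ) + 1) ^ (r (k + 1) + 1)
        ≤ ∏ k : Fin d, (if k ∈ T then (3 : ℝ) ^ (r d + 1) else 1) := by
          refine Finset.prod_le_prod (fun k _ => by positivity) fun k _ => ?_
          split_ifs
          · norm_num
            refine pow_le_pow_right₀ (by norm_num) (Nat.succ_le_succ (hr ?_ ?_ ?_))
            · exact Nat.succ_le_succ (Nat.zero_le _)
            · exact Nat.one_le_iff_ne_zero.mpr (Nat.ne_of_gt k.pos)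
            · exact k.2
          · simp
      _ = (3 : ℝ) ^ (l * (r d + 1)) := by
          rw [Finset.prod_ite_mem, Finset.univ_inter, Finset.prod_const, hT', ← pow_mul, mul_comm]
  · intro S _ T _ h
    ext k
    have := congrFun h k
    by_cases h1 : k ∈ S <;> by_cases h2 : k ∈ T <;> simp_all


/-! ### Strong polynomial and polynomial tractability. -/

open Filter Topology

/-- Testing `X = (2M+1)^(r_1+1)` gives `M ≤ C (3M)^(p(r_1+1))` for all `M ≥ 1`, impossible for large
`M` if `p(r_1+1) < 1`. -/
theorem le_of_forall_ncard_oddIndices_one_le {r : ℕ → ℕ} {C p : ℝ} (hp : 0 ≤ p)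
    (h : ∀ X : ℝ, 1 < X → ((oddIndices r 1 X).ncard : ℝ) ≤ C * X ^ p) :
    1 / ((r 1 : ℝ) + 1) ≤ p := by
  set a : ℝ := (r 1 : ℝ) + 1 with ha
  have ha0 : 0 < a := by positivity
  rw [div_le_iff₀ ha0]
  by_contra! hlt
  have hC : 0 ≤ C := by
    have := (Nat.cast_nonneg _).trans (h 2 one_lt_two)
    exact nonneg_of_mul_nonneg_left this (by positivity)
  have key : ∀ M : ℕ, 1 ≤ M → (M : ℝ) ^ (1 - p * a) ≤ C * 3 ^ (p * a) := by
    intro M hM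
    have hM0 : (0 : ℝ) < M := by exact_mod_cast hM
    have hM1 : (1 : ℝ) ≤ M := by exact_mod_cast hM
    have h1 := h ((2 * (M : ℝ) + 1) ^ (r 1 + 1))
      (one_lt_pow₀ (by linarith) (Nat.succ_ne_zero _))
    have h2 : (M : ℝ) ≤ (oddIndices r 1 ((2 * (M : ℝ) + 1) ^ (r 1 + 1))).ncard := by
      exact_mod_cast le_ncard_oddIndices_one r M
    have h3 : ((2 * (M : ℝ) + 1) ^ (r 1 + 1)) ^ p ≤ 3 ^ (p * a) * (M : ℝ) ^ (p * a) := by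
      rw [← Real.rpow_natCast, ← Real.rpow_mul (by positivity),
        ← Real.mul_rpow (by positivity) (by positivity)]
      have : ((r 1 + 1 : ℕ) : ℝ) * p = p * a := by rw [ha]; push_cast; ring
      rw [this]
      exact Real.rpow_le_rpow (by positivity) (by linarith) (by positivity)
    rw [Real.rpow_sub hM0, Real.rpow_one, div_le_iff₀ (by positivity), mul_assoc]
    exact h2.trans (h1.trans (mul_le_mul_of_nonneg_left h3 hC))
  have hlim : Tendsto (fun M : ℕ => (M : ℝ) ^ (1 - p * a)) atTop atTop :=
    (tendsto_rpow_atTop (by linarith)).comp tendsto_natCast_atTop_atTop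
  obtain ⟨M, hM, hM1⟩ :=
    ((hlim.eventually_gt_atTop (C * 3 ^ (p * a))).and (eventually_ge_atTop 1)).exists
  exact absurd (key M hM1) (not_le.mpr hM)

theorem tendsto_div_log_atTop (c : ℝ) :
    Tendsto (fun k : ℕ => c / Real.log (k : ℝ)) atTop (𝓝 0) :=
  (Real.tendsto_log_atTop.comp tendsto_natCast_atTop_atTop).const_div_atTop c

/-- Compare `(d/2)^l / l! ≤ d.choose l` with the assumed bound at `X = 2 * 3^(l(r_d+1))`. Taking
logarithms and dividing by `ln d` leaves `l - q ≤ p l (r_d+1) ln 3 / ln d + o(1)`; then pass to the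
liminf. The parameter `l` is free so that it can outgrow `q`. -/
theorem le_eulerAStar_of_forall_le {r : ℕ → ℕ} (hr : MonotoneOn r (Set.Ici 1)) {C p q : ℝ}
    (hC : 0 ≤ C) (hp : 0 < p) {l : ℕ} (hl : 0 < l)
    (h : ∀ d : ℕ, 1 ≤ d → ∀ X : ℝ, 1 < X →
      ((oddIndices r d X).ncard : ℝ) ≤ C * (d : ℝ) ^ q * X ^ p) :
    ((2 * ((l - q) / (p * l)) : ℝ) : EReal) ≤ eulerAStar r := by
  -- All constants independent of `d`; `C + 1` keeps the logarithm meaningful when `C = 0`.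
  set D : ℝ := Real.log ((C + 1) * 2 ^ p * (2 ^ l * l.factorial)) with hD
  have hl0 : (0 : ℝ) < l := by exact_mod_cast hl
  have hlog3 : 0 < Real.log 3 := Real.log_pos (by norm_num)
  have hlow : ∀ᶠ d : ℕ in atTop,
      (((2 / (p * l) * ((l - q) - D / Real.log d) : ℝ)) : EReal) ≤
        (((2 * (r d : ℝ) + 2) * Real.log 3 / Real.log (d : ℝ) : ℝ) : EReal) := by
    filter_upwards [eventually_ge_atTop (2 * l), eventually_ge_atTop 2] with d hd hd2
    rw [EReal.coe_le_coe_iff]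
    have hd0 : (0 : ℝ) < d := by exact_mod_cast (by lia : 0 < d)
    have hlogd : 0 < Real.log d := Real.log_pos (by exact_mod_cast (by lia : 1 < d))
    have h3 : (1 : ℝ) ≤ 3 ^ (l * (r d + 1)) := one_le_pow₀ (by norm_num)
    have h1 := h d (by lia) (2 * 3 ^ (l * (r d + 1))) (by linarith)
    have h2 : (d.choose l : ℝ) ≤ (oddIndices r d (2 * (3 : ℝ) ^ (l * (r d + 1)))).ncard := by
      exact_mod_cast choose_le_ncard_oddIndices hr d l
        (X := 2 * (3 : ℝ) ^ (l * (r d + 1))) (by linarith)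
    have h4 : ((d : ℝ) / 2) ^ l / l.factorial ≤ d.choose l := by
      refine le_trans ?_ (Nat.pow_le_choose l d)
      gcongr
      have : (d : ℝ) ≤ 2 * ((d + 1 - l : ℕ) : ℝ) := by exact_mod_cast (by lia)
      linarith
    have h5 : (d : ℝ) ^ (l : ℝ) ≤ ((C + 1) * 2 ^ p * (2 ^ l * l.factorial)) *
        ((d : ℝ) ^ q * ((3 : ℝ) ^ (l * (r d + 1))) ^ p) := by
      have h6 := h4.trans (h2.trans h1)
      rw [div_pow, div_div, div_le_iff₀ (by positivity),
        Real.mul_rpow (by positivity) (by positivity)] at h6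
      rw [Real.rpow_natCast]
      refine h6.trans ?_
      have : C * (d : ℝ) ^ q * (2 ^ p * ((3 : ℝ) ^ (l * (r d + 1))) ^ p) *
          (2 ^ l * l.factorial) = (C * 2 ^ p * (2 ^ l * l.factorial)) *
        ((d : ℝ) ^ q * ((3 : ℝ) ^ (l * (r d + 1))) ^ p) := by ring
      rw [this]
      gcongr
      linarith
    have h7 := Real.log_le_log (by positivity) h5
    rw [Real.log_mul (by positivity) (by positivity), ← hD,
      Real.log_mul (by positivity) (by positivity), Real.log_rpow hd0, Real.log_rpow hd0,
      Real.log_rpow (by positivity), Real.log_pow] at h7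
    push_cast at h7
    rw [le_div_iff₀ hlogd, mul_assoc, sub_mul, div_mul_cancel₀ _ hlogd.ne', div_mul_eq_mul_div,
      div_le_iff₀ (by positivity)]
    linarith
  have hlim : Tendsto (fun d : ℕ => ((2 / (p * l) * ((l - q) - D / Real.log d) : ℝ) : EReal))
      atTop (𝓝 ((2 * ((l - q) / (p * l)) : ℝ) : EReal)) := by
    refine (continuous_coe_real_ereal.tendsto _).comp ?_
    have := ((tendsto_div_log_atTop D).const_sub ((l : ℝ) - q)).const_mul (2 / (p * l))
    convert this using 2
    ring
  rw [← hlim.liminf_eq]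
  exact liminf_le_liminf hlow

/-- For `c` strictly between `2/p` and `A_*`, eventually `(2 r_k + 2) ln 3 > c ln k`, so the terms
are dominated by `k^(-cp/2)` with `cp/2 > 1`. -/
theorem summable_of_lt_eulerAStar {r : ℕ → ℕ} {p : ℝ} (hp : 0 < p)
    (h : ((2 / p : ℝ) : EReal) < eulerAStar r) :
    Summable fun k : ℕ => (3 : ℝ) ^ (-(p * ((r k : ℝ) + 1))) := by
  obtain ⟨c, hpc, hc⟩ := EReal.lt_iff_exists_real_btwn.mp h
  rw [EReal.coe_lt_coe_iff, div_lt_iff₀ hp] at hpc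
  have hs : Summable fun k : ℕ => (k : ℝ) ^ (-(c * p / 2)) :=
    Real.summable_nat_rpow.mpr (by linarith)
  refine Summable.of_norm_bounded_eventually_nat hs ?_
  filter_upwards [eventually_lt_of_lt_liminf hc, eventually_ge_atTop 2] with k hk hk2
  rw [EReal.coe_lt_coe_iff] at hk
  have hlogk : 0 < Real.log k := Real.log_pos (by exact_mod_cast (by lia : 1 < k))
  have hk0 : (0 : ℝ) < k := by exact_mod_cast (by lia : 0 < k)
  rw [lt_div_iff₀ hlogk] at hk
  rw [Real.norm_of_nonneg (by positivity), Real.rpow_def_of_pos (by norm_num),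
    Real.rpow_def_of_pos hk0]
  refine Real.exp_le_exp.mpr ?_
  nlinarith

/-- The two conditions on `p` play different roles: the first makes every univariate Dirichlet
series converge, uniformly in the coordinate by monotonicity; the second makes the constant
independent of `d`. -/
theorem sptBound_eulerComplexity {r : ℕ → ℕ} (hr : MonotoneOn r (Set.Ici 1)) {p : ℝ}
    (hp : 1 / ((r 1 : ℝ) + 1) < p) (h : ((2 / p : ℝ) : EReal) < eulerAStar r) :
    SPTBound (eulerComplexity r) p := by
  have ha : (0 : ℝ) < (r 1 : ℝ) + 1 := by positivity
  have hp0 : 0 < p := lt_trans (by positivity) hp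
  rw [div_lt_iff₀ ha] at hp
  obtain ⟨C, hC, hle⟩ := exists_ncard_oddIndices_le hp
  have hs := summable_of_lt_eulerAStar hp0 h
  set f : ℕ → ℝ := fun k => (3 : ℝ) ^ (-(p * ((r k : ℝ) + 1))) with hf
  refine ⟨Real.exp (C * ∑' k, f (k + 1)), by positivity, fun d hd ε hε hε1 => ?_⟩
  rw [eulerComplexity_le_iff r d hε hε1 (by positivity)]
  refine (hle r d ε⁻¹ p (by positivity) hp0.le fun k => ?_).trans ?_
  · have : r 1 ≤ r (k + 1) := hr (Set.mem_Ici.mpr le_rfl) (Set.mem_Ici.mpr (by lia)) (by lia)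
    gcongr
  · rw [mul_comm]
    gcongr
    rw [Fin.sum_univ_eq_sum_range (fun k => f (k + 1)) d]
    exact ((summable_nat_add_iff 1).mpr hs).sum_le_tsum _ fun k _ => by positivity

theorem ncard_le_of_ptBound {r : ℕ → ℕ} {F : ℕ → ℝ → ℝ} (hF : ∀ d X, 0 ≤ X → 0 ≤ F d X)
    (h : ∀ d : ℕ, 1 ≤ d → ∀ ε : ℝ, 0 < ε → ε < 1 →
      (eulerComplexity r ε d : ℝ≥0∞) ≤ ENNReal.ofReal (F d ε⁻¹)) {d : ℕ} (hd : 1 ≤ d) {X : ℝ}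
    (hX : 1 < X) : ((oddIndices r d X).ncard : ℝ) ≤ F d X := by
  have hX0 : 0 < X := zero_lt_one.trans hX
  have := h d hd X⁻¹ (inv_pos.mpr hX0) (inv_lt_one_of_one_lt₀ hX)
  rwa [eulerComplexity_le_iff r d (inv_pos.mpr hX0) (inv_lt_one_of_one_lt₀ hX)
    (hF _ _ (by rw [inv_inv]; exact hX0.le)), inv_inv] at this

theorem SPTBound.ncard_le {r : ℕ → ℕ} {p : ℝ} (h : SPTBound (eulerComplexity r) p) :
    ∃ C : ℝ, 0 ≤ C ∧ ∀ d : ℕ, 1 ≤ d → ∀ X : ℝ, 1 < X →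
      ((oddIndices r d X).ncard : ℝ) ≤ C * X ^ p := by
  obtain ⟨C, hC, h⟩ := h
  exact ⟨C, hC, fun d hd X hX => ncard_le_of_ptBound (F := fun _ X => C * X ^ p)
    (fun d X hX => by positivity) h hd hX⟩

theorem SPTBound.one_div_le {r : ℕ → ℕ} {p : ℝ} (hp : 0 ≤ p)
    (h : SPTBound (eulerComplexity r) p) : 1 / ((r 1 : ℝ) + 1) ≤ p := by
  obtain ⟨C, -, h⟩ := h.ncard_le
  exact le_of_forall_ncard_oddIndices_one_le hp (h 1 le_rfl)

theorem SPTBound.two_div_le {r : ℕ → ℕ} (hr : MonotoneOn r (Set.Ici 1)) {p : ℝ} (hp : 0 < p)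
    (h : SPTBound (eulerComplexity r) p) : ((2 / p : ℝ) : EReal) ≤ eulerAStar r := by
  obtain ⟨C, hC, h⟩ := h.ncard_le
  have := le_eulerAStar_of_forall_le hr (q := 0) (l := 1) hC hp one_pos fun d hd X hX => by
    simpa using h d hd X hX
  convert this using 2
  norm_num
  ring

theorem eulerAStar_pos_of_PT {r : ℕ → ℕ} (hr : MonotoneOn r (Set.Ici 1))
    (h : PT (eulerComplexity r)) : 0 < eulerAStar r := by
  obtain ⟨C, p, q, hC, hp, hq, h⟩ := h
  have hl := Nat.lt_floor_add_one q
  -- The choice `l = ⌊q⌋₊ + 1 > q` makes the lower bound positive; `p + 1` replaces `p`, which may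
  -- be 0.
  have := le_eulerAStar_of_forall_le hr (C := C) (p := p + 1) (q := q) (l := ⌊q⌋₊ + 1) hC
    (by linarith) (Nat.succ_pos _) fun d hd X hX => by
      refine (ncard_le_of_ptBound (F := fun d X => C * (d : ℝ) ^ q * X ^ p)
        (fun d X hX => by positivity) h hd hX).trans ?_
      refine mul_le_mul_of_nonneg_left ?_ (by positivity)
      exact Real.rpow_le_rpow_of_exponent_le hX.le (by linarith)
  refine lt_of_lt_of_le ?_ this
  rw [EReal.coe_pos]
  push_cast
  have : 0 < (⌊q⌋₊ : ℝ) + 1 - q := by linarith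
  positivity

theorem SPT.pt {N : ℝ → ℕ → ℕ∞} (h : SPT N) : PT N := by
  obtain ⟨p, hp, C, hC, h⟩ := h
  exact ⟨C, p, 0, hC, hp, le_rfl, by simpa using h⟩

theorem two_div_coe_lt_iff {A : EReal} (hA : 0 < A) {p : ℝ} (hp : 0 < p) :
    ((2 / p : ℝ) : EReal) < A ↔ 2 / A < p := by
  induction A with
  | bot => simp at hA
  | top => simp [hp]
  | coe a =>
    have ha : 0 < a := EReal.coe_pos.mp hA
    rw [show (2 : EReal) = ((2 : ℝ) : EReal) from rfl, ← EReal.coe_div, EReal.coe_lt_coe_iff,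
      EReal.coe_lt_coe_iff, div_lt_comm₀ hp ha]

theorem two_div_coe_le_iff {A : EReal} (hA : 0 < A) {p : ℝ} (hp : 0 < p) :
    ((2 / p : ℝ) : EReal) ≤ A ↔ 2 / A ≤ p := by
  induction A with
  | bot => simp at hA
  | top => simp [hp.le]
  | coe a =>
    have ha : 0 < a := EReal.coe_pos.mp hA
    rw [show (2 : EReal) = ((2 : ℝ) : EReal) from rfl, ← EReal.coe_div, EReal.coe_le_coe_iff,
      EReal.coe_le_coe_iff, div_le_comm₀ hp ha]

theorem two_div_lt_top {A : EReal} (hA : 0 < A) : 2 / A < ⊤ := by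
  induction A with
  | bot => simp at hA
  | top => simp
  | coe a =>
    rw [show (2 : EReal) = ((2 : ℝ) : EReal) from rfl, ← EReal.coe_div]
    exact EReal.coe_lt_top _

/-- The target `x` is arbitrary so that `x = ⊤` yields SPT, while `x` close to the maximum yields
the upper bound for the exponent. -/
theorem spt_of_eulerAStar_pos {r : ℕ → ℕ} (hr : MonotoneOn r (Set.Ici 1))
    (hA : 0 < eulerAStar r) {x : EReal}
    (hx : max (2 / eulerAStar r) ((1 / ((r 1 : ℝ) + 1) : ℝ) : EReal) < x) :
    ∃ p : ℝ, 0 ≤ p ∧ SPTBound (eulerComplexity r) p ∧ (p : EReal) < x := by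
  obtain ⟨p, hp, hpx⟩ := EReal.lt_iff_exists_real_btwn.mp hx
  obtain ⟨h2, h1⟩ := max_lt_iff.mp hp
  rw [EReal.coe_lt_coe_iff] at h1
  have hp0 : 0 < p := lt_trans (by positivity) h1
  exact ⟨p, hp0.le, sptBound_eulerComplexity hr h1 ((two_div_coe_lt_iff hA hp0).mpr h2), hpx⟩

theorem spt_eulerComplexity_iff {r : ℕ → ℕ} (hr : MonotoneOn r (Set.Ici 1)) :
    SPT (eulerComplexity r) ↔ 0 < eulerAStar r := by
  refine ⟨fun h => eulerAStar_pos_of_PT hr h.pt, fun hA => ?_⟩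
  obtain ⟨p, hp, h, -⟩ := spt_of_eulerAStar_pos hr hA
    (max_lt (two_div_lt_top hA) (EReal.coe_lt_top _))
  exact ⟨p, hp, h⟩

theorem exponentSPT_eulerComplexity {r : ℕ → ℕ} (hr : MonotoneOn r (Set.Ici 1))
    (hA : 0 < eulerAStar r) : exponentSPT (eulerComplexity r) =
      max (2 / eulerAStar r) ((1 / ((r 1 : ℝ) + 1) : ℝ) : EReal) := by
  refine le_antisymm (le_of_forall_gt fun x hx => ?_) (le_sInf ?_)
  · obtain ⟨p, hp, h, hpx⟩ := spt_of_eulerAStar_pos hr hA hx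
    have : exponentSPT (eulerComplexity r) ≤ (p : EReal) := sInf_le ⟨p, hp, h, rfl⟩
    exact this.trans_lt hpx
  · rintro _ ⟨p, hp, h, rfl⟩
    have h1 := h.one_div_le hp
    have hp0 : 0 < p := lt_of_lt_of_le (by positivity) h1
    exact max_le ((two_div_coe_le_iff hA hp0).mp (h.two_div_le hr hp0))
      (EReal.coe_le_coe_iff.mpr h1)

/-- The two sequences differ by `2 ln 3 / ln k`, which tends to 0; its finite limit also excludes
the indeterminate sums of extended reals. -/
theorem eulerAStar_eq (r : ℕ → ℕ) : eulerAStar r = ((2 * Real.log 3 : ℝ) : EReal) *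
    liminf (fun k : ℕ => (((r k : ℝ) / Real.log (k : ℝ) : ℝ) : EReal)) atTop := by
  have hc : (0 : EReal) ≤ ((2 * Real.log 3 : ℝ) : EReal) :=
    EReal.coe_nonneg.mpr (by have := Real.log_pos (by norm_num : (1 : ℝ) < 3); positivity)
  rw [← EReal.liminf_const_mul_of_nonneg_of_ne_top hc (EReal.coe_ne_top _)]
  set u : ℕ → EReal :=
    fun k => ((2 * Real.log 3 : ℝ) : EReal) * (((r k : ℝ) / Real.log (k : ℝ) : ℝ) : EReal)
  set v : ℕ → EReal := fun k => ((2 * Real.log 3 / Real.log (k : ℝ) : ℝ) : EReal) with hv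
  have hvl : Tendsto v atTop (𝓝 0) :=
    (continuous_coe_real_ereal.tendsto _).comp (tendsto_div_log_atTop (2 * Real.log 3))
  have huv : eulerAStar r = liminf (v + u) atTop := by
    rw [eulerAStar]
    congr 1
    ext k
    simp only [Pi.add_apply, u, v, ← EReal.coe_mul, ← EReal.coe_add]
    congr 1
    ring
  rw [huv]
  refine le_antisymm ?_ ?_
  · refine (EReal.liminf_add_le ?_ ?_).trans ?_ <;> simp [hvl.limsup_eq]
  · refine le_trans ?_ EReal.le_liminf_add
    simp [hvl.liminf_eq]


/-! ### Quasi-polynomial tractability. -/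

open Filter Topology

theorem one_le_log_three : 1 ≤ Real.log 3 := by
  rw [Real.le_log_iff_exp_le (by norm_num)]
  linarith [Real.exp_one_lt_d9]

/-- Apply the counting bound with `p = t(1 + ln d)`. Then `X^p` is the desired exponential, and
`p(r_k+1) ≥ 1 + ln d` with `ln 3 ≥ 1` makes each of the `d` terms `3^(-p(r_k+1))` at most `1/d`. The
constant `exp C` is therefore free of `d`. -/
theorem qptBound_eulerComplexity {r : ℕ → ℕ} (hr : MonotoneOn r (Set.Ici 1)) {t : ℝ}
    (ht : 1 / ((r 1 : ℝ) + 1) < t) : QPTBound (eulerComplexity r) t := by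
  have ha : (0 : ℝ) < (r 1 : ℝ) + 1 := by positivity
  have ht0 : 0 < t := lt_trans (by positivity) ht
  rw [div_lt_iff₀ ha] at ht
  obtain ⟨C, hC, hle⟩ := exists_ncard_oddIndices_le ht
  refine ⟨Real.exp C, Real.exp_pos C, fun d hd ε hε hε1 => ?_⟩
  rw [eulerComplexity_le_iff r d hε hε1 (by positivity)]
  have hd0 : (0 : ℝ) < d := by exact_mod_cast hd
  have hlogd : 0 ≤ Real.log d := Real.log_natCast_nonneg d
  have hX : 0 < ε⁻¹ := inv_pos.mpr hε
  have hk : ∀ k : Fin d, t * ((r 1 : ℝ) + 1) * (1 + Real.log d) ≤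
      t * (1 + Real.log d) * ((r (k + 1) : ℝ) + 1) := fun k => by
    have : r 1 ≤ r (k + 1) := hr (Set.mem_Ici.mpr le_rfl) (Set.mem_Ici.mpr (by lia)) (by lia)
    rw [mul_right_comm]
    gcongr
  have hsum : ∑ k : Fin d, (3 : ℝ) ^ (-(t * (1 + Real.log d) * ((r (k + 1) : ℝ) + 1))) ≤ 1 := by
    have : ∀ k : Fin d, (3 : ℝ) ^ (-(t * (1 + Real.log d) * ((r (k + 1) : ℝ) + 1))) ≤
        (d : ℝ)⁻¹ := by
      intro k
      rw [Real.rpow_def_of_pos (by norm_num), ← Real.exp_log hd0, ← Real.exp_neg, Real.exp_le_exp,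
        Real.exp_log hd0]
      have h1 := hk k
      have h2 : 1 + Real.log d ≤ t * ((r 1 : ℝ) + 1) * (1 + Real.log d) :=
        le_mul_of_one_le_left (by positivity) (by linarith)
      have h3 := one_le_log_three
      nlinarith
    calc _ ≤ ∑ _k : Fin d, (d : ℝ)⁻¹ := Finset.sum_le_sum fun k _ => this k
      _ = 1 := by simp [hd0.ne']
  refine (hle r d ε⁻¹ (t * (1 + Real.log d)) hX (by positivity) fun k => ?_).trans ?_
  · exact (le_mul_of_one_le_right (by positivity) (by linarith)).trans (hk k)
  · rw [mul_comm, Real.rpow_def_of_pos hX]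
    refine mul_le_mul (Real.exp_le_exp.mpr (mul_le_of_le_one_right hC hsum))
      (Real.exp_le_exp.mpr ?_) (by positivity) (by positivity)
    have : 0 ≤ t * (1 + Real.log d) := by positivity
    nlinarith

theorem QPTBound.ncard_le {r : ℕ → ℕ} {t : ℝ} (h : QPTBound (eulerComplexity r) t) :
    ∃ C : ℝ, 0 < C ∧ ∀ d : ℕ, 1 ≤ d → ∀ X : ℝ, 1 < X → ((oddIndices r d X).ncard : ℝ) ≤
      C * Real.exp (t * (1 + Real.log d) * (1 + Real.log X)) := by
  obtain ⟨C, hC, h⟩ := h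
  exact ⟨C, hC, fun d hd X hX => ncard_le_of_ptBound
    (F := fun d X => C * Real.exp (t * (1 + Real.log d) * (1 + Real.log X)))
    (fun d X hX => by positivity) h hd hX⟩

/-- At `d = 1` the QPT bound is the power bound `C e^t X^t`, so the univariate obstruction applies.
-/
theorem QPTBound.one_div_le {r : ℕ → ℕ} {t : ℝ} (ht : 0 ≤ t)
    (h : QPTBound (eulerComplexity r) t) : 1 / ((r 1 : ℝ) + 1) ≤ t := by
  obtain ⟨C, -, h⟩ := h.ncard_le
  refine le_of_forall_ncard_oddIndices_one_le (C := C * Real.exp t) ht fun X hX => ?_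
  refine (h 1 le_rfl X hX).trans (le_of_eq ?_)
  rw [Real.rpow_def_of_pos (zero_lt_one.trans hX), mul_assoc C, ← Real.exp_add]
  congr 2
  simp
  ring

theorem qpt_eulerComplexity {r : ℕ → ℕ} (hr : MonotoneOn r (Set.Ici 1)) :
    QPT (eulerComplexity r) :=
  ⟨1 / ((r 1 : ℝ) + 1) + 1, by positivity, qptBound_eulerComplexity hr (lt_add_one _)⟩

theorem exponentQPT_eulerComplexity {r : ℕ → ℕ} (hr : MonotoneOn r (Set.Ici 1)) :
    exponentQPT (eulerComplexity r) = ((1 / ((r 1 : ℝ) + 1) : ℝ) : EReal) := by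
  refine le_antisymm (le_of_forall_gt fun x hx => ?_) (le_sInf ?_)
  · obtain ⟨t, ht, htx⟩ := EReal.lt_iff_exists_real_btwn.mp hx
    rw [EReal.coe_lt_coe_iff] at ht
    have : exponentQPT (eulerComplexity r) ≤ (t : EReal) :=
      sInf_le ⟨t, lt_trans (by positivity) ht, qptBound_eulerComplexity hr ht, rfl⟩
    exact this.trans_lt htx
  · rintro _ ⟨t, ht, h, rfl⟩
    exact EReal.coe_le_coe_iff.mpr (h.one_div_le ht.le)

/-- The limit `B` is the supremum, hence at least the term at `k = 1`, and `ln 3 ≥ 1` gives `B ≥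
2(r_1+1)`. So `2/B` never decides the maximum. The shift by one is needed since monotonicity starts
at index 1. -/
theorem exists_tendsto_two_div_le {r : ℕ → ℕ} (hr : MonotoneOn r (Set.Ici 1)) : ∃ B : EReal,
    Tendsto (fun k : ℕ => (((2 * (r k : ℝ) + 2) * Real.log 3 : ℝ) : EReal)) atTop (𝓝 B) ∧
      2 / B ≤ ((1 / ((r 1 : ℝ) + 1) : ℝ) : EReal) := by
  set f : ℕ → EReal := fun k => (((2 * (r k : ℝ) + 2) * Real.log 3 : ℝ) : EReal)
  have h3 := one_le_log_three
  have hmono : Monotone fun k => f (k + 1) := by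
    intro i j hij
    have : r (i + 1) ≤ r (j + 1) :=
      hr (Set.mem_Ici.mpr (by lia)) (Set.mem_Ici.mpr (by lia)) (by lia)
    refine EReal.coe_le_coe_iff.mpr ?_
    gcongr
  have hlim := (tendsto_add_atTop_iff_nat 1).mp (tendsto_atTop_iSup hmono)
  refine ⟨_, hlim, ?_⟩
  have h1 : f 1 ≤ ⨆ k, f (k + 1) := le_iSup (fun k => f (k + 1)) 0
  have hpos : 0 < f 1 := EReal.coe_pos.mpr (by positivity)
  rw [← two_div_coe_le_iff (hpos.trans_le h1) (by positivity)]
  refine le_trans (EReal.coe_le_coe_iff.mpr ?_) h1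
  rw [div_div_eq_mul_div, div_one]
  nlinarith [(Nat.cast_nonneg (r 1) : (0 : ℝ) ≤ r 1)]

/-! ### Weak tractability notions. -/

theorem log_eulerComplexity (r : ℕ → ℕ) (d : ℕ) {ε : ℝ} (hε : 0 < ε) (hε1 : ε < 1) :
    ENNReal.log (eulerComplexity r ε d : ℝ≥0∞) =
      (Real.log ((oddIndices r d ε⁻¹).ncard : ℝ) : EReal) := by
  rw [eulerComplexity_eq_encard r d hε hε1, ← (finite_oddIndices r d ε⁻¹).cast_ncard_eq,
    ENat.toENNReal_coe, ENNReal.log_pos_real]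
  · simp
  · have := one_le_ncard_oddIndices r d ((one_lt_inv₀ hε).mpr hε1)
    exact_mod_cast (by lia)
  · exact ENNReal.natCast_ne_top _

/-- The larger of `ε⁻¹` and `d` is at least half their sum, and both are at least 1, so the sum of
powers dominates `((ε⁻¹ + d)/2)^(min s t)`. -/
theorem tendsto_add_rpow_tractabilityFilter {s t : ℝ} (hs : 0 < s) (ht : 0 < t) :
    Tendsto (fun x : ℝ × ℕ => x.1⁻¹ ^ s + (x.2 : ℝ) ^ t) tractabilityFilter atTop := by
  have h1 : Tendsto (fun x : ℝ × ℕ => x.1⁻¹ + (x.2 : ℝ)) tractabilityFilter atTop :=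
    tendsto_comap.mono_left inf_le_left
  have h2 := (tendsto_rpow_atTop (lt_min hs ht)).comp (h1.atTop_div_const two_pos)
  refine tendsto_atTop_mono' _ ?_ h2
  have : ∀ᶠ x in tractabilityFilter, x ∈ {x : ℝ × ℕ | 0 < x.1 ∧ x.1 < 1 ∧ 1 ≤ x.2} :=
    mem_inf_of_right (mem_principal_self _)
  filter_upwards [this] with x ⟨hx0, hx1, hx2⟩
  have hX : 1 ≤ x.1⁻¹ := (one_lt_inv₀ hx0).mpr hx1 |>.le
  have hd : (1 : ℝ) ≤ x.2 := by exact_mod_cast hx2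
  simp only [Function.comp_apply]
  rcases le_total x.1⁻¹ (x.2 : ℝ) with h | h
  · calc ((x.1⁻¹ + (x.2 : ℝ)) / 2) ^ min s t ≤ (x.2 : ℝ) ^ min s t :=
          Real.rpow_le_rpow (by positivity) (by linarith) (by positivity)
      _ ≤ (x.2 : ℝ) ^ t := Real.rpow_le_rpow_of_exponent_le hd (min_le_right _ _)
      _ ≤ _ := le_add_of_nonneg_left (by positivity)
  · calc ((x.1⁻¹ + (x.2 : ℝ)) / 2) ^ min s t ≤ x.1⁻¹ ^ min s t :=
          Real.rpow_le_rpow (by positivity) (by linarith) (by positivity)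
      _ ≤ x.1⁻¹ ^ s := Real.rpow_le_rpow_of_exponent_le hX (min_le_left _ _)
      _ ≤ _ := le_add_of_nonneg_right (by positivity)

/-- The exponent `1/4` is chosen so that the product of two such logarithmic factors is
`O(M^(1/2))`, hence `o(M)`. -/
theorem one_add_log_le {x a M : ℝ} (hx : 1 ≤ x) (ha : 0 < a) (hM : x ^ a ≤ M) :
    1 + Real.log x ≤ (1 + 1 / (a / 4)) * M ^ (1 / 4 : ℝ) := by
  have hx0 : 0 < x := zero_lt_one.trans_le hx
  have h1 : Real.log x ≤ x ^ (a / 4) / (a / 4) := Real.log_le_rpow_div hx0.le (by positivity)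
  have h2 : 1 ≤ x ^ (a / 4) := Real.one_le_rpow hx (by positivity)
  have h3 : x ^ (a / 4) ≤ M ^ (1 / 4 : ℝ) := by
    rw [div_eq_mul_one_div, Real.rpow_mul hx0.le]
    exact Real.rpow_le_rpow (by positivity) hM (by norm_num)
  calc 1 + Real.log x ≤ (1 + 1 / (a / 4)) * x ^ (a / 4) := by
        rw [add_mul, one_mul, one_div, inv_mul_eq_div]; linarith
    _ ≤ _ := by gcongr

/-- QPT suffices: it bounds `ln n` by a constant times `(1 + ln d)(1 + ln ε⁻¹)`, which is
`O(M^(1/2))` for `M = ε^(-s) + d^t`, and `M` tends to infinity. -/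
theorem stWeaklyTractable_eulerComplexity {r : ℕ → ℕ} (hr : MonotoneOn r (Set.Ici 1)) {s t : ℝ}
    (hs : 0 < s) (ht : 0 < t) : STWeaklyTractable (eulerComplexity r) s t := by
  obtain ⟨τ, hτ, h⟩ := qpt_eulerComplexity hr
  obtain ⟨C, hC, h⟩ := h.ncard_le
  set M : ℝ × ℕ → ℝ := fun x => x.1⁻¹ ^ s + (x.2 : ℝ) ^ t with hMdef
  have hM : Tendsto M tractabilityFilter atTop := tendsto_add_rpow_tractabilityFilter hs ht
  have hmem : ∀ᶠ x in tractabilityFilter, x ∈ {x : ℝ × ℕ | 0 < x.1 ∧ x.1 < 1 ∧ 1 ≤ x.2} :=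
    mem_inf_of_right (mem_principal_self _)
  set K : ℝ := (|Real.log C| + τ) * ((1 + 1 / (t / 4)) * (1 + 1 / (s / 4))) with hK
  have hreal : Tendsto (fun x : ℝ × ℕ =>
      Real.log ((oddIndices r x.2 x.1⁻¹).ncard : ℝ) / M x) tractabilityFilter (𝓝 0) := by
    have hz : Tendsto (fun x => K * M x ^ (-(1 / 2) : ℝ)) tractabilityFilter (𝓝 0) := by
      simpa using ((tendsto_rpow_neg_atTop (y := 1 / 2) (by norm_num)).comp hM).const_mul K
    refine squeeze_zero' ?_ ?_ hz
    · filter_upwards [hmem] with x ⟨hx0, hx1, hx2⟩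
      have := inv_pos.mpr hx0
      exact div_nonneg (Real.log_natCast_nonneg _) (by simp only [hMdef]; positivity)
    · filter_upwards [hmem] with x ⟨hx0, hx1, hx2⟩
      have hX : 1 < x.1⁻¹ := (one_lt_inv₀ hx0).mpr hx1
      have hX0 : 0 < x.1⁻¹ := zero_lt_one.trans hX
      have hd : (1 : ℝ) ≤ x.2 := by exact_mod_cast hx2
      have hMx : 0 < M x := by simp only [hMdef]; positivity
      have hcard : (0 : ℝ) < (oddIndices r x.2 x.1⁻¹).ncard := by
        exact_mod_cast one_le_ncard_oddIndices r x.2 hX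
      have h1 := Real.log_le_log hcard (h x.2 hx2 x.1⁻¹ hX)
      rw [Real.log_mul hC.ne' (Real.exp_ne_zero _), Real.log_exp] at h1
      have h2 := one_add_log_le hd ht (M := M x) (le_add_of_nonneg_left (by positivity))
      have h3 := one_add_log_le hX.le hs (M := M x) (le_add_of_nonneg_right (by positivity))
      have hL1 : 1 ≤ 1 + Real.log (x.2 : ℝ) := by linarith [Real.log_nonneg hd]
      have hL2 : 1 ≤ 1 + Real.log x.1⁻¹ := by linarith [Real.log_nonneg hX.le]
      have h4 := mul_le_mul h2 h3 (by linarith) (by positivity)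
      have h5 : M x ^ (1 / 4 : ℝ) * M x ^ (1 / 4 : ℝ) = M x ^ (-(1 / 2) : ℝ) * M x := by
        rw [← Real.rpow_add hMx, ← Real.rpow_add_one hMx.ne']
        norm_num
      rw [div_le_iff₀ hMx]
      calc _ ≤ Real.log C + τ * (1 + Real.log x.2) * (1 + Real.log x.1⁻¹) := h1
        _ ≤ (|Real.log C| + τ) * ((1 + Real.log x.2) * (1 + Real.log x.1⁻¹)) := by
          rw [add_mul, mul_assoc]
          gcongr
          exact (le_abs_self _).trans (le_mul_of_one_le_right (abs_nonneg _)
            (one_le_mul_of_one_le_of_one_le hL1 hL2))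
        _ ≤ (|Real.log C| + τ) * _ := mul_le_mul_of_nonneg_left h4 (by positivity)
        _ = K * M x ^ (-(1 / 2) : ℝ) * M x := by
          rw [mul_assoc K, ← h5, hK]; ring
  have := (continuous_coe_real_ereal.tendsto 0).comp hreal
  refine Tendsto.congr' ?_ this
  filter_upwards [hmem] with x ⟨hx0, hx1, hx2⟩
  rw [log_eulerComplexity r x.2 hx0 hx1, ← EReal.coe_div]
  rfl

theorem uwt_eulerComplexity {r : ℕ → ℕ} (hr : MonotoneOn r (Set.Ici 1)) :
    UWT (eulerComplexity r) :=
  fun _ _ hα hβ => stWeaklyTractable_eulerComplexity hr hα hβ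

theorem UWT.wt {N : ℝ → ℕ → ℕ∞} (h : UWT N) : WT N := by
  have := h 1 1 one_pos one_pos
  simpa only [STWeaklyTractable, WT, Real.rpow_one] using this

end EulerTractability

end

theorem mainTheorem3 (r : ℕ → ℕ) (hr : MonotoneOn r (Set.Ici 1)) :
    -- strong polynomial tractability and its exponent
    ((EulerTractability.SPT (EulerTractability.eulerComplexity r) ↔
        0 < EulerTractability.eulerAStar r) ∧
      EulerTractability.eulerAStar r =
        ((2 * Real.log 3 : ℝ) : EReal) *
          Filter.liminf (fun k : ℕ => (((r k : ℝ) / Real.log (k : ℝ) : ℝ) : EReal))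
            Filter.atTop ∧
      (EulerTractability.SPT (EulerTractability.eulerComplexity r) →
        EulerTractability.exponentSPT (EulerTractability.eulerComplexity r) =
          max (2 / EulerTractability.eulerAStar r) ((1 / ((r 1 : ℝ) + 1) : ℝ) : EReal))) ∧
    -- strong polynomial tractability versus polynomial tractability
    (EulerTractability.SPT (EulerTractability.eulerComplexity r) ↔
      EulerTractability.PT (EulerTractability.eulerComplexity r)) ∧
    -- quasi-polynomial tractability and its exponent
    (EulerTractability.QPT (EulerTractability.eulerComplexity r) ∧
      (∃ B : EReal,
        Filter.Tendsto (fun k : ℕ => (((2 * (r k : ℝ) + 2) * Real.log 3 : ℝ) : EReal))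
          Filter.atTop (nhds B) ∧
        EulerTractability.exponentQPT (EulerTractability.eulerComplexity r) =
          max (2 / B) ((1 / ((r 1 : ℝ) + 1) : ℝ) : EReal)) ∧
      EulerTractability.exponentQPT (EulerTractability.eulerComplexity r) =
        ((1 / ((r 1 : ℝ) + 1) : ℝ) : EReal)) ∧
    -- weak tractability notions
    (EulerTractability.UWT (EulerTractability.eulerComplexity r) ∧
      EulerTractability.WT (EulerTractability.eulerComplexity r) ∧
      ∀ s t : ℝ, 0 < s → 0 < t →
        EulerTractability.STWeaklyTractable (EulerTractability.eulerComplexity r) s t) := by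
  open EulerTractability in
  obtain ⟨B, hB, hle⟩ := exists_tendsto_two_div_le hr
  have hspt := spt_eulerComplexity_iff hr
  have hq := exponentQPT_eulerComplexity hr
  have hu := uwt_eulerComplexity hr
  exact ⟨⟨hspt, eulerAStar_eq r, fun h => exponentSPT_eulerComplexity hr (hspt.mp h)⟩,
    ⟨SPT.pt, fun h => hspt.mpr (eulerAStar_pos_of_PT hr h)⟩,
    ⟨qpt_eulerComplexity hr, ⟨B, hB, by rw [hq, max_eq_right hle]⟩, hq⟩,
    hu, hu.wt, hu⟩
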